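/- Let $\mu$ be the probability measure $\frac1\pi\frac{dx}{\sqrt{4-x^2}}$ on $[-2,2]$, and write $e(x)=e^{2\pi i x}$. There are an absolute constant $C$ and constants $D_k$, depending only on $k$, such that the following holds. Let $p$ be an odd prime, let $a_1,b_0\in(\mathbb Z/p\mathbb Z)^\times$, and let $(U_h)$, indexed by the integers $h$ such that $(a_1-h)b_0$ is a nonzero square modulo $p$, be independent identically distributed random variables of law $\mu$. For real $H>0$ and $t\in[0,1]$ put $$\mathrm{Kl}_H(t)=\sum_{\substack{|h|\le H\\ (a_1-h)b_0\in(\mathbb Z/p\mathbb Z)^{\times 2}}}\frac{e(ht)-1}{2\pi i h}\,U_h ,\qquad \mathrm{Kl}(t)=\lim_{H\to\infty}\mathrm{Kl}_H(t),$$ where the term $h=0$, if present, is interpreted as $tU_0$. Then: 1. The random series $\mathrm{Kl}$ converges almost surely and in law: as $H\to\infty$, $\mathrm{Kl}_H\to \mathrm{Kl}$ almost surely and in law in the Banach space $C^0([0,1],\mathbb C)$ with the supremum norm (in particular, for every $t\in[0,1]$, $\mathrm{Kl}_H(t)\to\mathrm{Kl}(t)$ almost surely). 2. Almost surely, $t\mapsto\mathrm{Kl}(t)$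 is continuous and nowhere differentiable on $[0,1]$ (at the end points, the one-sided derivative does not exist). 3. For every $t\in[0,1]$, $\mathbb E\big(e^{\lambda\,\mathrm{Re}\,\mathrm{Kl}(t)+\nu\,\mathrm{Im}\,\mathrm{Kl}(t)}\big)$ is finite for all $\lambda,\nu\in\mathbb Z_{\ge0}$, $\mathrm{Kl}(t)$ has moments of all orders, $\mathbb E(\mathrm{Kl}(t))=0$, and $\mathbb V(\mathrm{Kl}(t))=\mathbb E|\mathrm{Kl}(t)-\mathbb E\,\mathrm{Kl}(t)|^2\le 2t$. 4. For all real $H\ge2$, one has $\|\mathrm{Kl}_H\|_\infty=\sup_{t\in[0,1]}|\mathrm{Kl}_H(t)|\le C\log H$ almost surely, and for all $t\in[0,1]$ and all real $k\ge0$, $\mathbb E\big(|\mathrm{Kl}(t)-\mathrm{Kl}_H(t)|^k\big)\le D_kH^{-k/2}$. -/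

import Mathlib

open MeasureTheory ProbabilityTheory Filter Topology Set

noncomputable section

/-- The probability measure `(1/π) dx / √(4 - x²)` on `[-2, 2]`, as a measure on `ℝ`. -/
def sharpLaw : Measure ℝ :=
  (volume.restrict (Icc (-2 : ℝ) 2)).withDensity
    (fun x => ENNReal.ofReal (1 / (Real.pi * Real.sqrt (4 - x ^ 2))))

/-- The frequencies `h ∈ ℤ` such that `(a₁ - h) b₀` is the square of a unit modulo `p`. -/
def klFreq (p : ℕ) (a₁ b₀ : (ZMod p)ˣ) : Set ℤ :=
  {h | ∃ u : (ZMod p)ˣ, ((a₁ : ZMod p) - (h : ZMod p)) * (b₀ : ZMod p) = (u : ZMod p) ^ 2}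

/-- The coefficient `(e(ht) - 1) / (2πih)`, interpreted as `t` when `h = 0`. -/
def klCoeff (h : ℤ) (t : ℝ) : ℂ :=
  if h = 0 then (t : ℂ)
  else (Complex.exp (2 * Real.pi * Complex.I * h * t) - 1) / (2 * Real.pi * Complex.I * h)

open Classical in
/-- The integers `h` in `S` with `|h| ≤ H`. -/
def freqUpTo (S : Set ℤ) (H : ℝ) : Finset S :=
  (Finset.Icc (-⌊H⌋) ⌊H⌋).subtype (· ∈ S)

theorem mem_freqUpTo (S : Set ℤ) (H : ℝ) (h : S) :
    h ∈ freqUpTo S H ↔ |((h : ℤ) : ℝ)| ≤ H := by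
  simp only [freqUpTo, Finset.mem_subtype, Finset.mem_Icc, abs_le, neg_le (a := ⌊H⌋),
    Int.le_floor, Int.cast_neg]
  constructor <;> rintro ⟨h1, h2⟩ <;> constructor <;> linarith

theorem continuous_klCoeff (h : ℤ) : Continuous (klCoeff h) := by
  unfold klCoeff
  split_ifs <;> fun_prop

/-- The truncated random sum over the frequencies in `S` of absolute value at most `H`. -/
def klTrunc {Ω : Type*} {S : Set ℤ} (U : S → Ω → ℝ) (H t : ℝ) (ω : Ω) : ℂ :=
  ∑ h ∈ freqUpTo S H, klCoeff h t * (U h ω : ℂ)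

/-- The truncated sum as a random element of the Banach space `C⁰([0,1], ℂ)`. -/
def klTruncPath {Ω : Type*} {S : Set ℤ} (U : S → Ω → ℝ) (H : ℝ) (ω : Ω) :
    C(Icc (0 : ℝ) 1, ℂ) where
  toFun t := klTrunc U H t ω
  continuous_toFun := continuous_finsetSum _ fun h _ =>
    ((continuous_klCoeff h).comp continuous_subtype_val).mul continuous_const

/-- The random series: the limit of the truncated sums as `H → ∞`
(an arbitrary value at the `ω` for which there is no limit). -/
def klSeries {Ω : Type*} {S : Set ℤ} (U : S → Ω → ℝ) (t : ℝ) (ω : Ω) : ℂ :=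
  limUnder atTop (fun H : ℝ => klTrunc U H t ω)

/-- The Borel σ-algebra of the Banach space `C⁰([0,1], ℂ)`. -/
instance instMeasurableSpacePaths : MeasurableSpace C(Icc (0 : ℝ) 1, ℂ) := borel _

instance instBorelSpacePaths : BorelSpace C(Icc (0 : ℝ) 1, ℂ) := ⟨rfl⟩

end

/-!
The weights `U h` are bounded, centred, independent variables of variance `2`, and the coefficients
`klCoeff h t` are at most `1 / (π |h|)` in absolute value and `1`-Lipschitz in `t`.

*Moments.* By Hoeffding's lemma a weighted sum `X = ∑ wₕ Uₕ` satisfies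
`E exp (a |X|) ≤ 2 exp (8 a² v)` with `v = ∑ |wₕ|²` (`hasExpBound_sum`). The bound survives limits by
Fatou's lemma and controls every moment by the corresponding power of `v`. Since
`∑_{|h| > H} |klCoeff h t|² ≤ 1 / H`, this gives the moments of the tails; the variance bound is
Bessel's inequality for the indicator function of `[0, t]` (`sum_norm_klCoeff_sq_le`).

*Uniform convergence.* For `16 ^ n ≤ M ≤ 16 ^ (n + 1)` the difference `Kl_M - Kl_{16 ^ n}` has
variance `O(16 ^ (-n))` at each point, and it is Lipschitz with constant `O(16 ^ n)`. Its tenth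
moment, summed over all `M` and over a grid of mesh `32 ^ (-n)`, shows with the Borel-Cantelli lemma
that almost surely all these differences are eventually `O(2 ^ (-n))` in sup norm. Hence the paths
converge uniformly almost surely (`ae_exists_tendsto_klTruncPath`), and so in law.

*Nowhere differentiability.* Up to a linear term, the real part of the series is the sine series
`G(t) = ∑ Uₕ sin (2πht) / (2πh)`, which extends to an odd `1`-periodic function on the line; oddness
and periodicity turn a one-sided derivative at `0` or `1` into a two-sided one. If the series is
differentiable at `t`, then `|G(t + s) - G(t)| ≤ L |s|` for some `L`. Integrate `G(t + s)` against
the kernel `e(-Ns) D_B(s)² D_{3B}(s)`, where `D_n(s) = ∑_{j < n} e(-js)`. As `|s| |D_{3B}(s)|` is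
at most `1 / 2` and `∫ |D_B|² = B`, the result is `O(L B)` (`norm_bandSum_le`). On the other
hand it is a weighted sum over the band `N ≤ |h| < N + 5 B`, with weights of size `B² / N` on a
positive proportion of it, so its standard deviation is of order `B² √B / N`. For `B = R ^ 8` and
`N` of size `R ^ 10` this is at least a constant times `R ^ 9`, much more than `L R ^ 8`. By the
second moment method a single band sum is small with probability at most some `q < 1`, and `R`
disjoint bands are simultaneously small with probability at most `q ^ R`
(`measure_forall_norm_sum_lt_le`). This outweighs the `R ^ 16 + 1` grid points needed to control
all `t ∈ [0, 1]`. The set of frequencies enters only through the fact that it contains an arithmetic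
progression.
-/

noncomputable section

/-! ### The law `sharpLaw` and exponential moment bounds -/

theorem ae_mem_Icc_sharpLaw : ∀ᵐ x ∂sharpLaw, x ∈ Icc (-2 : ℝ) 2 :=
  (withDensity_absolutelyContinuous _ _).ae_le (ae_restrict_mem measurableSet_Icc)

theorem integral_sharpLaw (g : ℝ → ℝ) :
    ∫ x, g x ∂sharpLaw = ∫ x in (-2 : ℝ)..2, g x / (Real.pi * Real.sqrt (4 - x ^ 2)) := by
  rw [sharpLaw, integral_withDensity_eq_integral_toReal_smul (by fun_prop)
    (Eventually.of_forall fun _ => ENNReal.ofReal_lt_top),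
    intervalIntegral.integral_of_le (by norm_num), ← integral_Icc_eq_integral_Ioc]
  refine integral_congr_ae (Eventually.of_forall fun x => ?_)
  have : 0 ≤ 1 / (Real.pi * Real.sqrt (4 - x ^ 2)) := by positivity
  simp only [ENNReal.toReal_ofReal this, smul_eq_mul]
  ring

theorem integral_sq_sharpLaw : ∫ x, x ^ 2 ∂sharpLaw = 2 := by
  rw [integral_sharpLaw]
  -- the density is unbounded at `±2`, so the fundamental theorem of calculus is applied to a
  -- primitive which is only continuous there
  have hcont : ContinuousOn (fun x : ℝ =>
      Real.pi⁻¹ * (2 * Real.arcsin (x / 2) - x * Real.sqrt (4 - x ^ 2) / 2)) (Icc (-2) 2) := by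
    have := Real.continuous_arcsin
    fun_prop
  have hder : ∀ x ∈ Ioo (-2 : ℝ) 2, HasDerivAt (fun x : ℝ =>
      Real.pi⁻¹ * (2 * Real.arcsin (x / 2) - x * Real.sqrt (4 - x ^ 2) / 2))
      (x ^ 2 / (Real.pi * Real.sqrt (4 - x ^ 2))) x := by
    intro x hx
    have hpos : 0 < 4 - x ^ 2 := by nlinarith [hx.1, hx.2]
    have h1 : HasDerivAt (fun x : ℝ => Real.arcsin (x / 2))
        (1 / Real.sqrt (1 - (x / 2) ^ 2) * (1 / 2)) x :=
      (Real.hasDerivAt_arcsin (by linarith [hx.1]) (by linarith [hx.2])).comp x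
        ((hasDerivAt_id x).div_const 2)
    have h2 : HasDerivAt (fun x : ℝ => Real.sqrt (4 - x ^ 2))
        ((-(2 * x)) / (2 * Real.sqrt (4 - x ^ 2))) x := by
      have := ((hasDerivAt_pow 2 x).const_sub 4).sqrt hpos.ne'
      simpa using this
    have h3 := ((h1.const_mul 2).sub (((hasDerivAt_id x).mul h2).div_const 2)).const_mul Real.pi⁻¹
    refine h3.congr_deriv ?_
    have hs : Real.sqrt (1 - (x / 2) ^ 2) = Real.sqrt (4 - x ^ 2) / 2 := by
      rw [show 1 - (x / 2) ^ 2 = (4 - x ^ 2) / 2 ^ 2 by ring, Real.sqrt_div hpos.le,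
        Real.sqrt_sq (by norm_num)]
    have hp := Real.sqrt_pos.2 hpos
    have hsq := Real.sq_sqrt hpos.le
    rw [hs]
    simp only [id]
    field_simp
    rw [hsq]
    ring
  rw [intervalIntegral.integral_eq_sub_of_hasDerivAt_of_le (by norm_num) hcont hder]
  · norm_num
    field_simp
    norm_num
  · rw [intervalIntegrable_iff_integrableOn_Ioc_of_le (by norm_num)]
    exact intervalIntegral.integrableOn_deriv_of_nonneg hcont hder fun x _ => by positivity

theorem integral_id_sharpLaw : ∫ x, x ∂sharpLaw = 0 := by
  rw [integral_sharpLaw (fun x => x)]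
  have h := intervalIntegral.integral_comp_neg (a := (-2 : ℝ)) (b := 2)
    (fun x : ℝ => x / (Real.pi * Real.sqrt (4 - x ^ 2)))
  simp only [even_two.neg_pow, neg_neg, neg_div, intervalIntegral.integral_neg] at h
  linarith

/-- The moment generating bound satisfied by a sum `∑ wₕ Uₕ` with `∑ |wₕ|² ≤ v` and by the limits
of such sums: `E exp (a |X|) ≤ 2 exp (8 a² v)` for every `a ≥ 0`. -/
structure HasExpBound {Ω : Type*} [MeasurableSpace Ω] (X : Ω → ℂ) (v : ℝ) (P : Measure Ω) :
    Prop where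
  aemeasurable : AEMeasurable X P
  lintegral_le : ∀ a : ℝ, 0 ≤ a → ∫⁻ ω, ENNReal.ofReal (Real.exp (a * ‖X ω‖)) ∂P
    ≤ ENNReal.ofReal (2 * Real.exp (8 * a ^ 2 * v))

/-- A constant for which `E |X| ^ k ≤ momentConst k * v ^ (k / 2)` whenever `HasExpBound X v`. -/
def momentConst (k : ℝ) : ℝ := (⌈k⌉₊.factorial : ℝ) * (2 * Real.exp 8)

theorem momentConst_pos (k : ℝ) : 0 < momentConst k := by unfold momentConst; positivity

theorem rpow_le_factorial_mul_exp {k y : ℝ} (hk : 0 ≤ k) (hy : 0 ≤ y) :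
    y ^ k ≤ (⌈k⌉₊.factorial : ℝ) * Real.exp y := by
  have h1 : (1 : ℝ) ≤ (⌈k⌉₊.factorial : ℝ) := by exact_mod_cast Nat.factorial_pos _
  rcases le_total y 1 with h | h
  · exact (Real.rpow_le_one hy h hk).trans (one_le_mul_of_one_le_of_one_le h1 (Real.one_le_exp hy))
  · calc y ^ k ≤ y ^ (⌈k⌉₊ : ℝ) := Real.rpow_le_rpow_of_exponent_le h (Nat.le_ceil k)
      _ = y ^ ⌈k⌉₊ := Real.rpow_natCast _ _
      _ ≤ _ := by
        have := Real.pow_div_factorial_le_exp y hy ⌈k⌉₊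
        rw [div_le_iff₀ (by positivity)] at this
        linarith

/-- The scale `v ^ (1 / 2)` is the one at which the exponential bound `2 exp (8 a² v)` is a
constant. -/
theorem rpow_le_mul_exp {v y k : ℝ} (hv : 0 < v) (hy : 0 ≤ y) (hk : 0 ≤ k) :
    y ^ k ≤ v ^ (k / 2) * (⌈k⌉₊.factorial : ℝ) * Real.exp ((Real.sqrt v)⁻¹ * y) := by
  have hs := Real.sqrt_pos.2 hv
  have h := rpow_le_factorial_mul_exp hk (y := (Real.sqrt v)⁻¹ * y) (by positivity)
  rw [Real.mul_rpow (by positivity) (by positivity), Real.inv_rpow hs.le, inv_mul_le_iff₀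
    (by positivity), Real.sqrt_eq_rpow, ← Real.rpow_mul hv.le] at h
  rwa [Real.sqrt_eq_rpow, mul_assoc, div_eq_inv_mul k 2, ← one_div]

namespace HasExpBound

variable {Ω : Type*} [MeasurableSpace Ω] {P : Measure Ω} {X : Ω → ℂ} {v : ℝ}

theorem mono (h : HasExpBound X v P) {w : ℝ} (hvw : v ≤ w) : HasExpBound X w P :=
  ⟨h.1, fun a ha => (h.2 a ha).trans (ENNReal.ofReal_le_ofReal (by gcongr))⟩

theorem integrable_exp (h : HasExpBound X v P) {a : ℝ} (ha : 0 ≤ a) :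
    Integrable (fun ω => Real.exp (a * ‖X ω‖)) P := by
  have hm := h.1
  refine ⟨AEMeasurable.aestronglyMeasurable (by fun_prop), ?_⟩
  rw [hasFiniteIntegral_iff_ofReal (Eventually.of_forall fun _ => (Real.exp_pos _).le)]
  exact (h.2 a ha).trans_lt ENNReal.ofReal_lt_top

theorem integral_exp_le (h : HasExpBound X v P) {a : ℝ} (ha : 0 ≤ a) :
    ∫ ω, Real.exp (a * ‖X ω‖) ∂P ≤ 2 * Real.exp (8 * a ^ 2 * v) := by
  rw [integral_eq_lintegral_of_nonneg_ae (Eventually.of_forall fun _ => (Real.exp_pos _).le)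
    (h.integrable_exp ha).1]
  exact ENNReal.toReal_le_of_le_ofReal (by positivity) (h.2 a ha)

/-- Fatou's lemma: the bound passes to almost sure limits. -/
theorem of_tendsto {Y : ℕ → Ω → ℂ} (hY : ∀ n, HasExpBound (Y n) v P)
    (hlim : ∀ᵐ ω ∂P, Tendsto (fun n => Y n ω) atTop (𝓝 (X ω))) : HasExpBound X v P := by
  refine ⟨aemeasurable_of_tendsto_metrizable_ae atTop (fun n => (hY n).1) hlim, fun a ha => ?_⟩
  calc ∫⁻ ω, ENNReal.ofReal (Real.exp (a * ‖X ω‖)) ∂P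
      = ∫⁻ ω, liminf (fun n => ENNReal.ofReal (Real.exp (a * ‖Y n ω‖))) atTop ∂P := by
        refine lintegral_congr_ae (hlim.mono fun ω hω => ?_)
        refine (Tendsto.liminf_eq ?_).symm
        exact (ENNReal.continuous_ofReal.tendsto _).comp
          ((Real.continuous_exp.tendsto _).comp (hω.norm.const_mul a))
    _ ≤ liminf (fun n => ∫⁻ ω, ENNReal.ofReal (Real.exp (a * ‖Y n ω‖)) ∂P) atTop := by
        refine lintegral_liminf_le' fun n => ?_
        have := (hY n).1
        fun_prop
    _ ≤ _ := liminf_le_of_le (by isBoundedDefault) fun b hb => by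
        obtain ⟨n, hn⟩ := hb.exists
        exact hn.trans ((hY n).2 a ha)

theorem integrable_rpow (h : HasExpBound X v P) (hv : 0 < v) {k : ℝ} (hk : 0 ≤ k) :
    Integrable (fun ω => ‖X ω‖ ^ k) P := by
  have hm := h.1
  refine ((h.integrable_exp (a := (Real.sqrt v)⁻¹) (by positivity)).const_mul
    (v ^ (k / 2) * (⌈k⌉₊.factorial : ℝ))).mono'
    (AEMeasurable.aestronglyMeasurable (by fun_prop)) (Eventually.of_forall fun ω => ?_)
  rw [Real.norm_of_nonneg (by positivity)]
  exact rpow_le_mul_exp hv (norm_nonneg _) hk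

theorem integral_rpow_le (h : HasExpBound X v P) (hv : 0 < v) {k : ℝ} (hk : 0 ≤ k) :
    ∫ ω, ‖X ω‖ ^ k ∂P ≤ momentConst k * v ^ (k / 2) := by
  have hs := Real.sqrt_pos.2 hv
  have hi := h.integrable_exp (a := (Real.sqrt v)⁻¹) (by positivity)
  calc ∫ ω, ‖X ω‖ ^ k ∂P
      ≤ ∫ ω, v ^ (k / 2) * (⌈k⌉₊.factorial : ℝ) * Real.exp ((Real.sqrt v)⁻¹ * ‖X ω‖) ∂P :=
        integral_mono (h.integrable_rpow hv hk) (hi.const_mul _) fun ω =>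
          rpow_le_mul_exp hv (norm_nonneg _) hk
    _ = v ^ (k / 2) * (⌈k⌉₊.factorial : ℝ) * ∫ ω, Real.exp ((Real.sqrt v)⁻¹ * ‖X ω‖) ∂P :=
        integral_const_mul _ _
    _ ≤ v ^ (k / 2) * (⌈k⌉₊.factorial : ℝ) * (2 * Real.exp 8) := by
        gcongr
        refine (h.integral_exp_le (by positivity)).trans_eq ?_
        rw [inv_pow, Real.sq_sqrt hv.le, mul_assoc, inv_mul_cancel₀ hv.ne', mul_one]
    _ = _ := by unfold momentConst; ring

theorem integrable_pow (h : HasExpBound X v P) (hv : 0 < v) (k : ℕ) :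
    Integrable (fun ω => ‖X ω‖ ^ k) P := by
  simpa using h.integrable_rpow hv (k := k) (by positivity)

theorem integral_pow_le (h : HasExpBound X v P) (hv : 0 < v) (k : ℕ) :
    ∫ ω, ‖X ω‖ ^ (2 * k) ∂P ≤ momentConst (2 * k) * v ^ k := by
  have := h.integral_rpow_le hv (k := 2 * k) (by positivity)
  rw [mul_div_cancel_left₀ _ (two_ne_zero' ℝ), Real.rpow_natCast] at this
  exact_mod_cast this

theorem integrable [IsProbabilityMeasure P] (h : HasExpBound X v P) (hv : 0 < v) :
    Integrable X P :=
  (integrable_norm_iff h.1.aestronglyMeasurable).1 (by simpa using h.integrable_pow hv 1)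

/-- Markov's inequality for the moment of order `2 k`. -/
theorem measure_le (h : HasExpBound X v P) (hv : 0 < v) (k : ℕ) {a : ℝ} (ha : 0 < a) :
    P {ω | a ≤ ‖X ω‖} ≤ ENNReal.ofReal (momentConst (2 * k) * v ^ k / a ^ (2 * k)) := by
  have hm := h.1
  have h1 := meas_ge_le_lintegral_div (μ := P)
    (f := fun ω => ENNReal.ofReal (‖X ω‖ ^ (2 * k))) (by fun_prop)
    (ε := ENNReal.ofReal (a ^ (2 * k))) (by simp; positivity) ENNReal.ofReal_ne_top
  rw [← ofReal_integral_eq_lintegral_ofReal (h.integrable_pow hv _)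
    (Eventually.of_forall fun _ => by positivity), ← ENNReal.ofReal_div_of_pos (by positivity)] at h1
  refine (measure_mono fun ω hω => ?_).trans (h1.trans (ENNReal.ofReal_le_ofReal ?_))
  · exact ENNReal.ofReal_le_ofReal (pow_le_pow_left₀ ha.le hω _)
  · gcongr
    exact h.integral_pow_le hv k

end HasExpBound

/-! ### Weighted sums of independent variables of law `sharpLaw` -/

section RandomSums

variable {Ω : Type*} [MeasurableSpace Ω] {P : Measure Ω} {ι : Type*} {U : ι → Ω → ℝ}

theorem ae_abs_le_two {X : Ω → ℝ} (hX : HasLaw X sharpLaw P) : ∀ᵐ ω ∂P, |X ω| ≤ 2 := by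
  have h := ae_of_ae_map hX.aemeasurable (hX.map_eq ▸ ae_mem_Icc_sharpLaw)
  exact h.mono fun ω hω => abs_le.2 hω

theorem integral_eq_zero_of_hasLaw {X : Ω → ℝ} (hX : HasLaw X sharpLaw P) : ∫ ω, X ω ∂P = 0 := by
  rw [hX.integral_eq, integral_id_sharpLaw]

theorem integral_sq_of_hasLaw {X : Ω → ℝ} (hX : HasLaw X sharpLaw P) :
    ∫ ω, X ω ^ 2 ∂P = 2 := by
  have := hX.aemeasurable
  rw [← integral_sq_sharpLaw, ← hX.map_eq, integral_map this (by fun_prop)]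

theorem variance_of_hasLaw {X : Ω → ℝ} (hX : HasLaw X sharpLaw P) : variance X P = 2 := by
  rw [variance_of_integral_eq_zero hX.aemeasurable (integral_eq_zero_of_hasLaw hX),
    integral_sq_of_hasLaw hX]

theorem iIndepFun.const_mul_real (hU : iIndepFun U P) (w : ι → ℝ) :
    iIndepFun (fun h ω => w h * U h ω) P :=
  hU.comp (fun h x => w h * x) fun h => by fun_prop

theorem aemeasurable_sum_mul (hlaw : ∀ h, HasLaw (U h) sharpLaw P) (F : Finset ι) (w : ι → ℂ) :
    AEMeasurable (fun ω => ∑ h ∈ F, w h * (U h ω : ℂ)) P := by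
  have := fun h => (hlaw h).aemeasurable
  fun_prop

theorem re_sum_mul (F : Finset ι) (w : ι → ℂ) (u : ι → ℝ) :
    (∑ h ∈ F, w h * (u h : ℂ)).re = ∑ h ∈ F, (w h).re * u h := by
  simp

theorem im_sum_mul (F : Finset ι) (w : ι → ℂ) (u : ι → ℝ) :
    (∑ h ∈ F, w h * (u h : ℂ)).im = ∑ h ∈ F, (w h).im * u h := by
  simp

variable [IsProbabilityMeasure P]

theorem memLp_of_hasLaw {X : Ω → ℝ} (hX : HasLaw X sharpLaw P) (q : ENNReal) : MemLp X q P :=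
  MemLp.of_bound hX.aemeasurable.aestronglyMeasurable 2 (ae_abs_le_two hX)

theorem hasSubgaussianMGF_of_hasLaw {X : Ω → ℝ} (hX : HasLaw X sharpLaw P) :
    HasSubgaussianMGF X 4 P := by
  have h := hasSubgaussianMGF_of_mem_Icc_of_integral_eq_zero hX.aemeasurable
    ((ae_abs_le_two hX).mono fun ω hω => abs_le.1 hω) (integral_eq_zero_of_hasLaw hX)
  convert h using 1
  ext
  norm_num

theorem hasSubgaussianMGF_sum (hU : iIndepFun U P) (hlaw : ∀ h, HasLaw (U h) sharpLaw P)
    (F : Finset ι) (w : ι → ℝ) :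
    HasSubgaussianMGF (fun ω => ∑ h ∈ F, w h * U h ω)
      (∑ h ∈ F, Real.toNNReal (w h ^ 2) * 4) P :=
  HasSubgaussianMGF.sum_of_iIndepFun (iIndepFun.const_mul_real hU w)
    fun h _ => by
      rw [Real.toNNReal_of_nonneg (sq_nonneg _)]
      exact (hasSubgaussianMGF_of_hasLaw (hlaw h)).const_mul (w h)

theorem lintegral_exp_sum_le (hU : iIndepFun U P) (hlaw : ∀ h, HasLaw (U h) sharpLaw P)
    (F : Finset ι) (w : ι → ℝ) (b : ℝ) :
    ∫⁻ ω, ENNReal.ofReal (Real.exp (b * ∑ h ∈ F, w h * U h ω)) ∂P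
      ≤ ENNReal.ofReal (Real.exp (2 * b ^ 2 * ∑ h ∈ F, w h ^ 2)) := by
  have h := hasSubgaussianMGF_sum hU hlaw F w
  rw [← ofReal_integral_eq_lintegral_ofReal (h.integrable_exp_mul b)
    (Eventually.of_forall fun _ => (Real.exp_pos _).le)]
  refine ENNReal.ofReal_le_ofReal ((h.mgf_le b).trans (Real.exp_le_exp.2 (le_of_eq ?_)))
  push_cast
  simp only [Real.coe_toNNReal _ (sq_nonneg _), ← Finset.sum_mul]
  ring

/-- Hoeffding's lemma for the real and the imaginary part of a weighted sum. -/
theorem hasExpBound_sum (hU : iIndepFun U P) (hlaw : ∀ h, HasLaw (U h) sharpLaw P)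
    (F : Finset ι) (w : ι → ℂ) :
    HasExpBound (fun ω => ∑ h ∈ F, w h * (U h ω : ℂ)) (∑ h ∈ F, ‖w h‖ ^ 2) P := by
  refine ⟨aemeasurable_sum_mul hlaw F w, fun a ha => ?_⟩
  have hmeas := fun h => (hlaw h).aemeasurable
  set v := ∑ h ∈ F, ‖w h‖ ^ 2
  set R : Ω → ℝ := fun ω => ∑ h ∈ F, (w h).re * U h ω
  set I : Ω → ℝ := fun ω => ∑ h ∈ F, (w h).im * U h ω
  have hR : AEMeasurable R P := by fun_prop
  have hI : AEMeasurable I P := by fun_prop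
  have hvR : ∑ h ∈ F, (w h).re ^ 2 ≤ v := Finset.sum_le_sum fun h _ => by
    rw [Complex.sq_norm, Complex.normSq_apply]; nlinarith [sq_nonneg (w h).im]
  have hvI : ∑ h ∈ F, (w h).im ^ 2 ≤ v := Finset.sum_le_sum fun h _ => by
    rw [Complex.sq_norm, Complex.normSq_apply]; nlinarith [sq_nonneg (w h).re]
  have key : ∀ (w' : ι → ℝ), ∑ h ∈ F, w' h ^ 2 ≤ v → ∀ b : ℝ, b ^ 2 = 4 * a ^ 2 →
      ∫⁻ ω, ENNReal.ofReal (Real.exp (b * ∑ h ∈ F, w' h * U h ω)) ∂P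
        ≤ ENNReal.ofReal (Real.exp (8 * a ^ 2 * v)) := fun w' hw' b hb =>
    (lintegral_exp_sum_le hU hlaw F w' b).trans (ENNReal.ofReal_le_ofReal
      (Real.exp_le_exp.2 (by rw [hb]; nlinarith [sq_nonneg a])))
  -- `exp (a (|R| + |I|))` is at most the arithmetic mean of `exp (2a|R|)` and `exp (2a|I|)`
  have hpt : ∀ ω, Real.exp (a * ‖∑ h ∈ F, w h * (U h ω : ℂ)‖) ≤ 2⁻¹ * (Real.exp ((2 * a) * R ω)
      + Real.exp ((-(2 * a)) * R ω) + Real.exp ((2 * a) * I ω) + Real.exp ((-(2 * a)) * I ω)) := by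
    intro ω
    have h1 := Complex.norm_le_abs_re_add_abs_im (∑ h ∈ F, w h * (U h ω : ℂ))
    rw [re_sum_mul F w fun h => U h ω, im_sum_mul F w fun h => U h ω] at h1
    have h2 : ∀ x : ℝ, Real.exp (a * |x|) ^ 2
        ≤ Real.exp ((2 * a) * x) + Real.exp ((-(2 * a)) * x) := by
      intro x
      rw [← Real.exp_nat_mul]
      rcases abs_cases x with ⟨hx, _⟩ | ⟨hx, _⟩ <;> rw [hx]
      · have := Real.exp_pos ((-(2 * a)) * x)
        push_cast
        rw [show 2 * (a * x) = 2 * a * x by ring]; linarith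
      · have := Real.exp_pos ((2 * a) * x)
        push_cast
        rw [show 2 * (a * -x) = -(2 * a) * x by ring]; linarith
    have h3 : Real.exp (a * ‖∑ h ∈ F, w h * (U h ω : ℂ)‖)
        ≤ Real.exp (a * |R ω|) * Real.exp (a * |I ω|) := by
      rw [← Real.exp_add, ← mul_add]
      exact Real.exp_le_exp.2 (mul_le_mul_of_nonneg_left h1 ha)
    nlinarith [h2 (R ω), h2 (I ω), sq_nonneg (Real.exp (a * |R ω|) - Real.exp (a * |I ω|))]
  calc ∫⁻ ω, ENNReal.ofReal (Real.exp (a * ‖∑ h ∈ F, w h * (U h ω : ℂ)‖)) ∂P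
      ≤ ∫⁻ ω, ENNReal.ofReal 2⁻¹ * (ENNReal.ofReal (Real.exp ((2 * a) * R ω))
        + ENNReal.ofReal (Real.exp ((-(2 * a)) * R ω)) + ENNReal.ofReal (Real.exp ((2 * a) * I ω))
        + ENNReal.ofReal (Real.exp ((-(2 * a)) * I ω))) ∂P := by
        refine lintegral_mono fun ω => ?_
        rw [← ENNReal.ofReal_add (by positivity) (by positivity),
          ← ENNReal.ofReal_add (by positivity) (by positivity),
          ← ENNReal.ofReal_add (by positivity) (by positivity),
          ← ENNReal.ofReal_mul (by positivity)]
        exact ENNReal.ofReal_le_ofReal (hpt ω)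
    _ ≤ ENNReal.ofReal 2⁻¹ * (ENNReal.ofReal (Real.exp (8 * a ^ 2 * v))
        + ENNReal.ofReal (Real.exp (8 * a ^ 2 * v)) + ENNReal.ofReal (Real.exp (8 * a ^ 2 * v))
        + ENNReal.ofReal (Real.exp (8 * a ^ 2 * v))) := by
        rw [lintegral_const_mul' _ _ ENNReal.ofReal_ne_top, lintegral_add_left' (by fun_prop),
          lintegral_add_left' (by fun_prop), lintegral_add_left' (by fun_prop)]
        gcongr
        · exact key (fun h => (w h).re) hvR _ (by ring)
        · exact key (fun h => (w h).re) hvR _ (by ring)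
        · exact key (fun h => (w h).im) hvI _ (by ring)
        · exact key (fun h => (w h).im) hvI _ (by ring)
    _ = _ := by
        rw [← ENNReal.ofReal_add (by positivity) (by positivity),
          ← ENNReal.ofReal_add (by positivity) (by positivity),
          ← ENNReal.ofReal_add (by positivity) (by positivity),
          ← ENNReal.ofReal_mul (by positivity)]
        ring_nf

theorem integral_sum_mul (hlaw : ∀ h, HasLaw (U h) sharpLaw P) (F : Finset ι) (w : ι → ℂ) :
    ∫ ω, ∑ h ∈ F, w h * (U h ω : ℂ) ∂P = 0 := by
  rw [integral_finsetSum]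
  · refine Finset.sum_eq_zero fun h _ => ?_
    rw [integral_const_mul, integral_complex_ofReal, integral_eq_zero_of_hasLaw (hlaw h)]
    simp
  · intro h _
    exact (((memLp_of_hasLaw (hlaw h) 1).integrable le_rfl).ofReal).const_mul _

theorem integral_sq_sum_real (hU : iIndepFun U P) (hlaw : ∀ h, HasLaw (U h) sharpLaw P)
    (F : Finset ι) (w : ι → ℝ) :
    ∫ ω, (∑ h ∈ F, w h * U h ω) ^ 2 ∂P = 2 * ∑ h ∈ F, w h ^ 2 := by
  have hmem : ∀ h, MemLp (fun ω => w h * U h ω) 2 P := fun h =>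
    (memLp_of_hasLaw (hlaw h) 2).const_mul (w h)
  have h1 := IndepFun.variance_sum (s := F) (fun h _ => hmem h)
    fun i _ j _ hij => (iIndepFun.const_mul_real hU w).indepFun hij
  have h0 : ∫ ω, (∑ h ∈ F, fun ω => w h * U h ω) ω ∂P = 0 := by
    simp only [Finset.sum_apply]
    rw [integral_finsetSum _ fun h _ => (hmem h).integrable one_le_two]
    exact Finset.sum_eq_zero fun h _ => by
      rw [integral_const_mul, integral_eq_zero_of_hasLaw (hlaw h), mul_zero]
  have hm : AEMeasurable (∑ h ∈ F, fun ω => w h * U h ω) P :=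
    (memLp_finsetSum' F fun h _ => hmem h).aemeasurable
  rw [variance_of_integral_eq_zero hm h0] at h1
  simp only [Finset.sum_apply] at h1
  rw [h1, Finset.mul_sum]
  refine Finset.sum_congr rfl fun h _ => ?_
  rw [variance_const_mul, variance_of_hasLaw (hlaw h), mul_comm]

theorem integral_norm_sq_sum_mul (hU : iIndepFun U P) (hlaw : ∀ h, HasLaw (U h) sharpLaw P)
    (F : Finset ι) (w : ι → ℂ) :
    ∫ ω, ‖∑ h ∈ F, w h * (U h ω : ℂ)‖ ^ 2 ∂P = 2 * ∑ h ∈ F, ‖w h‖ ^ 2 := by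
  have hint : ∀ w' : ι → ℝ, Integrable (fun ω => (∑ h ∈ F, w' h * U h ω) ^ 2) P := fun w' =>
    (memLp_finsetSum F fun h _ => (memLp_of_hasLaw (hlaw h) 2).const_mul (w' h)).integrable_sq
  simp only [Complex.sq_norm, Complex.normSq_apply, ← sq]
  simp only [re_sum_mul F w fun h => U h _, im_sum_mul F w fun h => U h _]
  rw [integral_add (hint _) (hint _), integral_sq_sum_real hU hlaw, integral_sq_sum_real hU hlaw,
    ← mul_add, ← Finset.sum_add_distrib]

/-- A lower bound for the probability that a weighted sum `∑ wₕ Uₕ` has absolute value at least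
`(∑ |wₕ|²) ^ (1 / 2)`. -/
def spreadConst : ℝ := (momentConst 4)⁻¹

theorem spreadConst_pos : 0 < spreadConst := inv_pos.2 (momentConst_pos _)

/-- The second moment method of Paley and Zygmund: the second moment of `X = ∑ wₕ Uₕ` is
`2 ∑ |wₕ|²` and its fourth moment is at most a constant times the square of this. -/
theorem measure_norm_sum_lt_le (hU : iIndepFun U P) (hlaw : ∀ h, HasLaw (U h) sharpLaw P)
    (F : Finset ι) (w : ι → ℂ) {a : ℝ} (ha0 : 0 < a) (ha : a ^ 2 ≤ ∑ h ∈ F, ‖w h‖ ^ 2) :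
    P {ω | ‖∑ h ∈ F, w h * (U h ω : ℂ)‖ < a} ≤ ENNReal.ofReal (1 - spreadConst) := by
  set v := ∑ h ∈ F, ‖w h‖ ^ 2
  have hv : 0 < v := lt_of_lt_of_le (by positivity) ha
  have hb := hasExpBound_sum hU hlaw F w
  set X : Ω → ℂ := fun ω => ∑ h ∈ F, w h * (U h ω : ℂ)
  set B : Set Ω := {ω | ‖X ω‖ < a}
  have hB : NullMeasurableSet Bᶜ P := (hb.1.norm.nullMeasurable measurableSet_Iio).compl
  set D := momentConst 4
  have hD : 0 < D := momentConst_pos _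
  have h4 : ∫ ω, ‖X ω‖ ^ 4 ∂P ≤ D * v ^ 2 := by
    have := hb.integral_pow_le hv 2
    norm_num at this
    exact this
  have h2 : ∫ ω, ‖X ω‖ ^ 2 ∂P = 2 * v := integral_norm_sq_sum_mul hU hlaw F w
  have hi4 := hb.integrable_pow hv 4
  have hi2 := hb.integrable_pow hv 2
  have hi1 : Integrable (Bᶜ.indicator fun _ => D * v / 2) P :=
    (integrable_const _).indicator₀ hB
  -- where `|X| ≥ a`, this is `y ≤ D v / 2 + y² / (2 D v)` with `y = |X|²`; the weights are chosen
  -- so that the fourth moment absorbs only half of `v`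
  have hle : ∫ ω, ‖X ω‖ ^ 2 ∂P ≤
      ∫ ω, (v + Bᶜ.indicator (fun _ => D * v / 2) ω + ‖X ω‖ ^ 4 * (2 * D * v)⁻¹) ∂P := by
    refine integral_mono hi2 (((integrable_const v).add hi1).add (hi4.mul_const _)) fun ω => ?_
    by_cases hω : ω ∈ B
    · have h1 : ‖X ω‖ ^ 2 ≤ v := (pow_le_pow_left₀ (norm_nonneg _) (le_of_lt hω) 2).trans ha
      have h3 : 0 ≤ ‖X ω‖ ^ 4 * (2 * D * v)⁻¹ := by positivity
      simp only [Set.indicator_of_notMem (show ω ∉ Bᶜ from fun h => h hω)]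
      linarith
    · simp only [Set.indicator_of_mem (show ω ∈ Bᶜ from hω)]
      have h3 : ‖X ω‖ ^ 2 ≤ D * v / 2 + ‖X ω‖ ^ 4 * (2 * D * v)⁻¹ := by
        rw [← sub_nonneg]
        have : D * v / 2 + ‖X ω‖ ^ 4 * (2 * D * v)⁻¹ - ‖X ω‖ ^ 2
            = (D * v - ‖X ω‖ ^ 2) ^ 2 * (2 * D * v)⁻¹ := by
          field_simp
          ring
        rw [this]
        positivity
      linarith
  have hi3 : Integrable (fun ω => v + Bᶜ.indicator (fun _ => D * v / 2) ω) P :=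
    (integrable_const v).add hi1
  rw [integral_add hi3 (hi4.mul_const _),
    integral_add (integrable_const v) hi1, integral_const, integral_mul_const,
    integral_indicator₀ hB, setIntegral_const, h2] at hle
  simp only [probReal_univ, smul_eq_mul, one_mul] at hle
  have h5 : (∫ ω, ‖X ω‖ ^ 4 ∂P) * (2 * D * v)⁻¹ ≤ v / 2 := by
    rw [← div_eq_mul_inv, div_le_iff₀ (by positivity)]
    linarith
  have h6 : D⁻¹ ≤ P.real Bᶜ := by
    rw [inv_le_iff_one_le_mul₀ hD]
    have : v * 1 ≤ v * (P.real Bᶜ * D) := by linarith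
    exact le_of_mul_le_mul_left this hv
  have h7 : P.real B = 1 - P.real Bᶜ := by
    have := probReal_compl_eq_one_sub₀ (μ := P) hB
    rwa [compl_compl] at this
  rw [← ofReal_measureReal]
  refine ENNReal.ofReal_le_ofReal ?_
  rw [h7]
  exact sub_le_sub_left h6 1

end RandomSums

/-! ### The coefficients of the random series -/

/-- Each natural number is the absolute value of at most two integers. -/
theorem sum_natAbs_le {F : Finset ℤ} {T : Finset ℕ} {g : ℕ → ℝ} (hg : ∀ n, 0 ≤ g n)
    (hF : ∀ h ∈ F, h.natAbs ∈ T) : ∑ h ∈ F, g h.natAbs ≤ 2 * ∑ n ∈ T, g n := by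
  rw [← Finset.sum_fiberwise_of_maps_to hF, Finset.mul_sum]
  refine Finset.sum_le_sum fun n _ => ?_
  have h1 : ∑ h ∈ F.filter (fun h => h.natAbs = n), g h.natAbs
      = ((F.filter (fun h => h.natAbs = n)).card : ℝ) * g n := by
    rw [Finset.sum_congr rfl (g := fun _ => g n) fun h hh => by rw [(Finset.mem_filter.1 hh).2],
      Finset.sum_const, nsmul_eq_mul]
  have h2 : (F.filter (fun h => h.natAbs = n)).card ≤ 2 := by
    refine (Finset.card_le_card (t := {(n : ℤ), -(n : ℤ)}) fun h hh => ?_).trans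
      Finset.card_le_two
    simpa using Int.natAbs_eq_iff.1 (Finset.mem_filter.1 hh).2
  rw [h1]
  exact mul_le_mul_of_nonneg_right (by exact_mod_cast h2) (hg n)

theorem sum_subtype_le {S : Set ℤ} {F : Finset S} {G : Finset ℤ} {f : ℤ → ℝ} (hf : ∀ h, 0 ≤ f h)
    (hFG : ∀ h ∈ F, (h : ℤ) ∈ G) : ∑ h ∈ F, f h ≤ ∑ h ∈ G, f h := by
  have h1 : ∑ h ∈ F, f h = ∑ h ∈ F.map (Function.Embedding.subtype _), f h := by simp
  rw [h1]
  refine Finset.sum_le_sum_of_subset_of_nonneg (fun x hx => ?_) fun h _ _ => hf h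
  obtain ⟨y, hy, rfl⟩ := Finset.mem_map.1 hx
  exact hFG y hy

theorem klCoeff_zero_left (t : ℝ) : klCoeff 0 t = t := if_pos rfl

theorem norm_two_pi_I_mul_int (h : ℤ) :
    ‖(2 * Real.pi * Complex.I * h : ℂ)‖ = 2 * Real.pi * |(h : ℝ)| := by
  simp [abs_of_pos Real.pi_pos]

theorem norm_exp_sub_exp (x y : ℝ) :
    ‖Complex.exp (2 * Real.pi * Complex.I * x) - Complex.exp (2 * Real.pi * Complex.I * y)‖
      = 2 * |Real.sin (Real.pi * (x - y))| := by
  have h1 : Complex.exp (2 * Real.pi * Complex.I * x) - Complex.exp (2 * Real.pi * Complex.I * y)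
      = Complex.exp (Complex.I * ((2 * Real.pi * y : ℝ) : ℂ)) *
        (Complex.exp (Complex.I * ((2 * Real.pi * (x - y) : ℝ) : ℂ)) - 1) := by
    rw [mul_sub, ← Complex.exp_add, mul_one]
    congr 2 <;> push_cast <;> ring
  rw [h1, norm_mul, Complex.norm_exp_I_mul_ofReal, one_mul, Complex.norm_exp_I_mul_ofReal_sub_one]
  rw [Real.norm_eq_abs, abs_mul, abs_two]
  ring_nf

theorem norm_exp_sub_exp_le (x y : ℝ) :
    ‖Complex.exp (2 * Real.pi * Complex.I * x) - Complex.exp (2 * Real.pi * Complex.I * y)‖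
      ≤ 2 * Real.pi * |x - y| := by
  rw [norm_exp_sub_exp]
  have := Real.abs_sin_le_abs (x := Real.pi * (x - y))
  rw [abs_mul, abs_of_pos Real.pi_pos] at this
  linarith

theorem norm_klCoeff {h : ℤ} (hh : h ≠ 0) (t : ℝ) :
    ‖klCoeff h t‖ = |Real.sin (Real.pi * (h * t))| / (Real.pi * |(h : ℝ)|) := by
  have h1 := norm_exp_sub_exp (h * t) 0
  simp only [Complex.ofReal_zero, mul_zero, Complex.exp_zero, sub_zero] at h1
  rw [klCoeff, if_neg hh, norm_div, norm_two_pi_I_mul_int]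
  push_cast at h1
  rw [show (2 * Real.pi * Complex.I * h * t : ℂ) = 2 * Real.pi * Complex.I * (h * t) by ring, h1,
    mul_assoc, mul_div_mul_left _ _ two_ne_zero]

theorem norm_klCoeff_le {h : ℤ} (hh : h ≠ 0) (t : ℝ) :
    ‖klCoeff h t‖ ≤ 1 / (Real.pi * |(h : ℝ)|) := by
  rw [norm_klCoeff hh]
  gcongr
  exact Real.abs_sin_le_one _

theorem norm_klCoeff_sq {h : ℤ} (hh : h ≠ 0) (t : ℝ) :
    ‖klCoeff h t‖ ^ 2
      = (1 - Real.cos (2 * Real.pi * h.natAbs * t)) / (2 * Real.pi ^ 2 * (h.natAbs : ℝ) ^ 2) := by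
  have h1 : (h.natAbs : ℝ) = |(h : ℝ)| := by simp
  have h2 : Real.cos (2 * Real.pi * |(h : ℝ)| * t) = Real.cos (2 * (Real.pi * (h * t))) := by
    rcases abs_choice (h : ℝ) with h | h <;> rw [h]
    · ring_nf
    · rw [← Real.cos_neg]; ring_nf
  have hh' : |(h : ℝ)| ≠ 0 := by simpa using hh
  rw [norm_klCoeff hh, h1, h2, div_pow, sq_abs, Real.sin_sq_eq_half_sub]
  field_simp

theorem norm_klCoeff_sub_le (h : ℤ) (t s : ℝ) : ‖klCoeff h t - klCoeff h s‖ ≤ |t - s| := by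
  unfold klCoeff
  split_ifs with hh
  · rw [← Complex.ofReal_sub, Complex.norm_real, Real.norm_eq_abs]
  · have hh' : 0 < |(h : ℝ)| := by simpa using hh
    rw [← sub_div, sub_sub_sub_cancel_right, norm_div, norm_two_pi_I_mul_int,
      div_le_iff₀ (by positivity)]
    have := norm_exp_sub_exp_le (h * t) (h * s)
    rw [← mul_sub, abs_mul] at this
    push_cast at this
    simp only [← mul_assoc] at this
    linarith

/-- A consequence of the Fourier series of the second Bernoulli polynomial. -/
theorem hasSum_one_sub_cos {t : ℝ} (ht : t ∈ Icc (0 : ℝ) 1) :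
    HasSum (fun n : ℕ => (1 - Real.cos (2 * Real.pi * n * t)) / (2 * Real.pi ^ 2 * (n : ℝ) ^ 2))
      ((t - t ^ 2) / 2) := by
  have h1 := hasSum_one_div_nat_pow_mul_cos one_ne_zero ht
  have h2 := (hasSum_zeta_two.sub h1).mul_left (1 / (2 * Real.pi ^ 2))
  have h3 : (Polynomial.map (algebraMap ℚ ℝ) (Polynomial.bernoulli (2 * 1))).eval t
      = t ^ 2 - t + 1 / 6 := by
    simp [Polynomial.bernoulli, Finset.sum_range_succ, bernoulli_eq_bernoulli'_of_ne_one,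
      bernoulli'_two, bernoulli_one]
    ring
  rw [h3] at h2
  have h4 : (t - t ^ 2) / 2 = 1 / (2 * Real.pi ^ 2) * (Real.pi ^ 2 / 6 -
      (-1) ^ (1 + 1) * (2 * Real.pi) ^ (2 * 1) / 2 / ((2 * 1).factorial : ℝ)
        * (t ^ 2 - t + 1 / 6)) := by
    norm_num [Nat.factorial]
    field_simp
    ring
  rw [h4]
  refine h2.congr_fun fun n => ?_
  rw [mul_one]
  ring

/-- Bessel's inequality for the indicator function of `[0, t]`. -/
theorem sum_norm_klCoeff_sq_le {t : ℝ} (ht : t ∈ Icc (0 : ℝ) 1) (F : Finset ℤ) :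
    ∑ h ∈ F, ‖klCoeff h t‖ ^ 2 ≤ t := by
  classical
  set g : ℕ → ℝ := fun n =>
    (1 - Real.cos (2 * Real.pi * n * t)) / (2 * Real.pi ^ 2 * (n : ℝ) ^ 2)
  have hg : ∀ n, 0 ≤ g n := fun n =>
    div_nonneg (by linarith [Real.cos_le_one (2 * Real.pi * n * t)]) (by positivity)
  have h1 : ∑ h ∈ F, ‖klCoeff h t‖ ^ 2 ≤ ∑ h ∈ insert 0 (F.erase 0), ‖klCoeff h t‖ ^ 2 :=
    Finset.sum_le_sum_of_subset_of_nonneg (fun x hx => by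
      rcases eq_or_ne x 0 with h | h <;> simp [*]) fun _ _ _ => by positivity
  have h2 : ∑ h ∈ F.erase 0, ‖klCoeff h t‖ ^ 2 = ∑ h ∈ F.erase 0, g h.natAbs :=
    Finset.sum_congr rfl fun h hh => norm_klCoeff_sq (Finset.ne_of_mem_erase hh) t
  have h3 := sum_natAbs_le (F := F.erase 0) (T := (F.erase 0).image Int.natAbs) hg
    fun h hh => Finset.mem_image_of_mem _ hh
  have h4 := sum_le_hasSum ((F.erase 0).image Int.natAbs) (fun n _ => hg n) (hasSum_one_sub_cos ht)
  rw [Finset.sum_insert (by simp), klCoeff_zero_left, Complex.norm_real, Real.norm_eq_abs, sq_abs,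
    h2] at h1
  linarith

theorem sum_norm_klCoeff_sq_le_of_lt {n : ℕ} (hn : n ≠ 0) {F : Finset ℤ}
    (hF : ∀ h ∈ F, n < h.natAbs) (t : ℝ) : ∑ h ∈ F, ‖klCoeff h t‖ ^ 2 ≤ 1 / (2 * n) := by
  set g : ℕ → ℝ := fun m => (1 / Real.pi ^ 2) * ((m : ℝ) ^ 2)⁻¹
  obtain ⟨M, hM⟩ : ∃ M : ℕ, ∀ h ∈ F, h.natAbs ≤ n + M :=
    ⟨F.sup Int.natAbs, fun h hh => (Finset.le_sup (f := Int.natAbs) hh).trans (by omega)⟩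
  have h1 : ∑ h ∈ F, ‖klCoeff h t‖ ^ 2 ≤ ∑ h ∈ F, g h.natAbs := by
    refine Finset.sum_le_sum fun h hh => ?_
    have h0 : h ≠ 0 := by rintro rfl; simpa using hF 0 hh
    refine (pow_le_pow_left₀ (norm_nonneg _) (norm_klCoeff_le h0 t) 2).trans_eq ?_
    have : (h.natAbs : ℝ) = |(h : ℝ)| := by simp
    simp only [g, this]
    rw [div_pow, mul_pow]
    field_simp
  have h2 := sum_natAbs_le (F := F) (T := Finset.Ioc n (n + M)) (g := g)
    (fun m => by positivity) fun h hh => Finset.mem_Ioc.2 ⟨hF h hh, hM h hh⟩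
  have h3 := sum_Ioc_inv_sq_le_sub (α := ℝ) hn (Nat.le_add_right n M)
  rw [← Finset.mul_sum (Finset.Ioc n (n + M))] at h2
  have hn' : (0 : ℝ) < n := by positivity
  have h4 : (0 : ℝ) ≤ ((n + M : ℕ) : ℝ)⁻¹ := by positivity
  have hpi : 1 / Real.pi ^ 2 ≤ 1 / 4 := by
    gcongr
    nlinarith [Real.pi_gt_three]
  have h5 : ∑ i ∈ Finset.Ioc n (n + M), ((i : ℝ) ^ 2)⁻¹ ≤ (n : ℝ)⁻¹ := by linarith
  calc _ ≤ _ := h1.trans h2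
    _ ≤ 2 * (1 / 4 * (n : ℝ)⁻¹) := by gcongr
    _ = _ := by field_simp; norm_num

theorem sum_norm_klCoeff_le_log {H : ℝ} (hH : 2 ≤ H) (t : ℝ) (ht : t ∈ Icc (0 : ℝ) 1) :
    ∑ h ∈ Finset.Icc (-⌊H⌋) ⌊H⌋, ‖klCoeff h t‖ ≤ 7 * Real.log H := by
  classical
  have hfl : 0 ≤ ⌊H⌋ := Int.floor_nonneg.2 (by linarith)
  set F := (Finset.Icc (-⌊H⌋) ⌊H⌋).erase 0
  set g : ℕ → ℝ := fun m => (m : ℝ)⁻¹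
  have h1 : ∑ h ∈ Finset.Icc (-⌊H⌋) ⌊H⌋, ‖klCoeff h t‖ = ‖klCoeff 0 t‖ + ∑ h ∈ F, ‖klCoeff h t‖ :=
    (Finset.add_sum_erase _ _ (by simp [hfl])).symm
  have h2 : ∑ h ∈ F, ‖klCoeff h t‖ ≤ ∑ h ∈ F, g h.natAbs := by
    refine Finset.sum_le_sum fun h hh => ?_
    have h0 : h ≠ 0 := Finset.ne_of_mem_erase hh
    have h0' : 0 < |(h : ℝ)| := by simpa using h0
    refine (norm_klCoeff_le h0 t).trans ?_
    have : (h.natAbs : ℝ) = |(h : ℝ)| := by simp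
    simp only [g, this, one_div]
    gcongr
    nlinarith [Real.pi_gt_three]
  have h3 := sum_natAbs_le (F := F) (T := Finset.Icc 1 ⌊H⌋₊) (g := g)
    (fun m => by positivity) fun h hh => by
      have := Finset.mem_Icc.1 (Finset.mem_of_mem_erase hh)
      have h0 : h ≠ 0 := Finset.ne_of_mem_erase hh
      have h4 : (⌊H⌋₊ : ℤ) = ⌊H⌋ := Int.natCast_floor_eq_floor (by linarith)
      rw [Finset.mem_Icc]
      omega
  have h4 := harmonic_floor_le_one_add_log H (by linarith)
  rw [harmonic_eq_sum_Icc] at h4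
  push_cast at h4
  change ∑ n ∈ Finset.Icc 1 ⌊H⌋₊, g n ≤ _ at h4
  have h6 : ‖klCoeff 0 t‖ ≤ 1 := by
    rw [klCoeff_zero_left, Complex.norm_real, Real.norm_eq_abs, abs_of_nonneg ht.1]
    exact ht.2
  have h7 : (2 / 3 : ℝ) < Real.log H :=
    lt_of_lt_of_le (by linarith [Real.log_two_gt_d9]) (Real.log_le_log (by norm_num) hH)
  rw [h1]
  linarith

/-! ### Almost sure uniform convergence -/

section Convergence

variable {Ω : Type*} {S : Set ℤ} {U : S → Ω → ℝ}

theorem freqUpTo_mono {H H' : ℝ} (h : H ≤ H') : freqUpTo S H ⊆ freqUpTo S H' := fun x hx =>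
  (mem_freqUpTo S H' x).2 (((mem_freqUpTo S H x).1 hx).trans h)

open Classical in
theorem klTrunc_sub {H H' : ℝ} (h : H ≤ H') (t : ℝ) (ω : Ω) :
    klTrunc U H' t ω - klTrunc U H t ω
      = ∑ h ∈ freqUpTo S H' \ freqUpTo S H, klCoeff h t * (U h ω : ℂ) := by
  rw [klTrunc, klTrunc, ← Finset.sum_sdiff (freqUpTo_mono h), add_sub_cancel_right]

theorem klTrunc_floor {H : ℝ} (hH : 0 ≤ H) (t : ℝ) (ω : Ω) :
    klTrunc U (⌊H⌋₊ : ℝ) t ω = klTrunc U H t ω := by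
  have : ⌊((⌊H⌋₊ : ℕ) : ℝ)⌋ = ⌊H⌋ := by
    rw [Int.floor_natCast, Int.natCast_floor_eq_floor hH]
  simp only [klTrunc, freqUpTo, this]

theorem klTruncPath_floor {H : ℝ} (hH : 0 ≤ H) (ω : Ω) :
    klTruncPath U (⌊H⌋₊ : ℝ) ω = klTruncPath U H ω :=
  ContinuousMap.ext fun t => klTrunc_floor (U := U) hH t ω

open Classical in
theorem sum_norm_klCoeff_sq_sdiff_le {H H' : ℝ} (hH : 1 ≤ H) (t : ℝ) :
    ∑ h ∈ freqUpTo S H' \ freqUpTo S H, ‖klCoeff h t‖ ^ 2 ≤ 1 / H := by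
  have hn : ⌊H⌋₊ ≠ 0 := (Nat.floor_pos.2 hH).ne'
  refine (sum_subtype_le (f := fun h => ‖klCoeff h t‖ ^ 2) (fun h => by positivity)
    fun h hh => Finset.mem_image_of_mem Subtype.val hh).trans
    ((sum_norm_klCoeff_sq_le_of_lt hn (fun h hh => ?_) t).trans ?_)
  · obtain ⟨x, hx, rfl⟩ := Finset.mem_image.1 hh
    rw [Finset.mem_sdiff, mem_freqUpTo, mem_freqUpTo, not_le] at hx
    rw [Nat.floor_lt (by linarith)]
    simpa using hx.2
  · have h1 := Nat.lt_floor_add_one H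
    have h2 : (1 : ℝ) ≤ ⌊H⌋₊ := by exact_mod_cast Nat.floor_pos.2 hH
    gcongr
    linarith

theorem norm_klTruncPath_le {ω : Ω} (hω : ∀ h, |U h ω| ≤ 2) {H : ℝ} (hH : 2 ≤ H) :
    ‖klTruncPath U H ω‖ ≤ 14 * Real.log H := by
  have hlog : 0 ≤ Real.log H := Real.log_nonneg (by linarith)
  rw [ContinuousMap.norm_le _ (by positivity)]
  intro t
  have h1 := sum_norm_klCoeff_le_log hH t t.2
  have h2 := sum_subtype_le (S := S) (F := freqUpTo S H) (G := Finset.Icc (-⌊H⌋) ⌊H⌋)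
    (f := fun h => ‖klCoeff h t‖) (fun h => norm_nonneg _)
    fun h hh => by simpa [freqUpTo] using hh
  calc ‖klTrunc U H t ω‖ ≤ ∑ h ∈ freqUpTo S H, ‖klCoeff h t * (U h ω : ℂ)‖ := norm_sum_le _ _
    _ ≤ ∑ h ∈ freqUpTo S H, ‖klCoeff h t‖ * 2 := Finset.sum_le_sum fun h _ => by
        rw [norm_mul, Complex.norm_real]
        exact mul_le_mul_of_nonneg_left (hω h) (norm_nonneg _)
    _ ≤ _ := by rw [← Finset.sum_mul]; linarith

/-- The difference of two truncations is Lipschitz in the time variable. -/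
theorem norm_klTrunc_sub_sub_le {ω : Ω} (hω : ∀ h, |U h ω| ≤ 2) {N M : ℕ} (hNM : N ≤ M)
    (t s : ℝ) :
    ‖(klTrunc U M t ω - klTrunc U N t ω) - (klTrunc U M s ω - klTrunc U N s ω)‖
      ≤ 4 * M * |t - s| := by
  classical
  have hNM' : (N : ℝ) ≤ M := by exact_mod_cast hNM
  rw [klTrunc_sub hNM', klTrunc_sub hNM', ← Finset.sum_sub_distrib]
  set F := freqUpTo S (M : ℝ) \ freqUpTo S (N : ℝ)
  have hcard : ∑ h ∈ F, (1 : ℝ) ≤ 2 * M := by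
    refine (sum_subtype_le (f := fun _ => (1 : ℝ)) (fun _ => zero_le_one)
      fun h hh => Finset.mem_image_of_mem Subtype.val hh).trans
      ((sum_natAbs_le (g := fun _ => (1 : ℝ)) (T := Finset.Ioc 0 M) (fun _ => zero_le_one)
        fun h hh => ?_).trans_eq (by simp))
    obtain ⟨x, hx, rfl⟩ := Finset.mem_image.1 hh
    rw [Finset.mem_sdiff, mem_freqUpTo, mem_freqUpTo, not_le] at hx
    have h1 : ((x : ℤ).natAbs : ℝ) = |((x : ℤ) : ℝ)| := by simp
    rw [← h1] at hx
    have h2 : (x : ℤ).natAbs ≤ M := by exact_mod_cast hx.1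
    have h3 : N < (x : ℤ).natAbs := by exact_mod_cast hx.2
    rw [Finset.mem_Ioc]
    omega
  calc _ ≤ ∑ h ∈ F, ‖klCoeff h t * (U h ω : ℂ) - klCoeff h s * (U h ω : ℂ)‖ := norm_sum_le _ _
    _ ≤ ∑ h ∈ F, (2 * |t - s|) * 1 := Finset.sum_le_sum fun h _ => by
        rw [← sub_mul, norm_mul, Complex.norm_real, Real.norm_eq_abs]
        nlinarith [norm_klCoeff_sub_le h t s, hω h, norm_nonneg (klCoeff h t - klCoeff h s),
          abs_nonneg (U h ω), abs_nonneg (t - s)]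
    _ ≤ _ := by
        rw [← Finset.mul_sum]
        nlinarith [abs_nonneg (t - s)]

/-- The event that some truncation `Kl_M` with `16 ^ n ≤ M ≤ 16 ^ (n + 1)` differs from
`Kl_{16 ^ n}` by at least `2 ^ (-n)` at some point of the grid of mesh `32 ^ (-n)`. -/
def oscillationEvent (U : S → Ω → ℝ) (n : ℕ) : Set Ω :=
  ⋃ M ∈ Finset.Icc (16 ^ n) (16 ^ (n + 1)), ⋃ j ∈ Finset.range (32 ^ n + 1),
    {ω | (1 / 2 : ℝ) ^ n ≤ ‖klTrunc U (M : ℕ) ((j : ℕ) / 32 ^ n : ℝ) ω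
      - klTrunc U ((16 ^ n : ℕ) : ℝ) ((j : ℕ) / 32 ^ n : ℝ) ω‖}

/-- Outside the oscillation event, the Lipschitz bound carries the estimate from the grid to the
whole of `[0, 1]`. -/
theorem norm_klTruncPath_sub_le {ω : Ω} (hω : ∀ h, |U h ω| ≤ 2) {n : ℕ}
    (hn : ω ∉ oscillationEvent U n) {M : ℕ} (hM : M ∈ Finset.Icc (16 ^ n) (16 ^ (n + 1))) :
    ‖klTruncPath U M ω - klTruncPath U ((16 ^ n : ℕ) : ℝ) ω‖ ≤ 65 * (1 / 2) ^ n := by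
  rw [ContinuousMap.norm_le _ (by positivity)]
  intro t
  set j := ⌊(t : ℝ) * 32 ^ n⌋₊
  have hp : (0 : ℝ) < 32 ^ n := by positivity
  have ht0 : 0 ≤ (t : ℝ) * 32 ^ n := mul_nonneg t.2.1 hp.le
  have hj1 : (j : ℝ) ≤ t * 32 ^ n := Nat.floor_le ht0
  have hj2 : (t : ℝ) * 32 ^ n < j + 1 := Nat.lt_floor_add_one _
  have hj : j ∈ Finset.range (32 ^ n + 1) := by
    rw [Finset.mem_range, Nat.lt_succ_iff]
    have : (j : ℝ) ≤ 32 ^ n := hj1.trans (mul_le_of_le_one_left hp.le t.2.2)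
    exact_mod_cast this
  have h1 : |(t : ℝ) - j / 32 ^ n| ≤ (1 / 32) ^ n := by
    rw [one_div, inv_pow, ← one_div, abs_of_nonneg (by rw [sub_nonneg, div_le_iff₀ hp]; exact hj1),
      sub_le_iff_le_add, ← add_div, le_div_iff₀ hp]
    linarith
  have h2 : ‖klTrunc U (M : ℕ) (j / 32 ^ n : ℝ) ω
      - klTrunc U ((16 ^ n : ℕ) : ℝ) (j / 32 ^ n : ℝ) ω‖ < (1 / 2 : ℝ) ^ n := by
    by_contra! h
    exact hn (mem_biUnion hM (mem_biUnion hj h))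
  have hM' := Finset.mem_Icc.1 hM
  have h3 := norm_klTrunc_sub_sub_le hω hM'.1 (t : ℝ) (j / 32 ^ n)
  have h4 : 4 * (M : ℝ) * |(t : ℝ) - j / 32 ^ n| ≤ 64 * (1 / 2) ^ n := by
    have h5 : (M : ℝ) ≤ 16 ^ (n + 1) := by exact_mod_cast hM'.2
    calc _ ≤ 4 * (16 : ℝ) ^ (n + 1) * (1 / 32) ^ n := by gcongr
      _ = 64 * (16 * (1 / 32)) ^ n := by rw [mul_pow]; ring
      _ = _ := by norm_num
  have h6 := norm_add_le ((klTrunc U M t ω - klTrunc U ((16 ^ n : ℕ) : ℝ) t ω)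
    - (klTrunc U M (j / 32 ^ n : ℝ) ω - klTrunc U ((16 ^ n : ℕ) : ℝ) (j / 32 ^ n : ℝ) ω))
    (klTrunc U M (j / 32 ^ n : ℝ) ω - klTrunc U ((16 ^ n : ℕ) : ℝ) (j / 32 ^ n : ℝ) ω)
  rw [sub_add_cancel] at h6
  change ‖klTrunc U M t ω - klTrunc U ((16 ^ n : ℕ) : ℝ) t ω‖ ≤ _
  linarith

/-- The truncations at `16 ^ n` form a Cauchy sequence, and the others are close to them. -/
theorem exists_tendsto_klTruncPath {ω : Ω} (hω : ∀ h, |U h ω| ≤ 2)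
    (hosc : ∀ᶠ n in atTop, ω ∉ oscillationEvent U n) :
    ∃ K, Tendsto (fun H : ℝ => klTruncPath U H ω) atTop (𝓝 K) := by
  obtain ⟨n₀, hn₀⟩ := eventually_atTop.1 hosc
  set u : ℕ → C(Icc (0 : ℝ) 1, ℂ) := fun n => klTruncPath U ((16 ^ n : ℕ) : ℝ) ω
  have hu : ∀ n, dist (u (n + n₀)) (u (n + 1 + n₀)) ≤ 65 * (1 / 2) ^ n := by
    intro n
    have := norm_klTruncPath_sub_le hω (hn₀ (n + n₀) (by omega)) (M := 16 ^ (n + n₀ + 1))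
      (by rw [Finset.mem_Icc]; exact ⟨Nat.pow_le_pow_right (by norm_num) (by omega), le_rfl⟩)
    rw [dist_comm, dist_eq_norm, show n + 1 + n₀ = n + n₀ + 1 by ring]
    refine this.trans ?_
    rw [pow_add]
    have h1 : ((1 : ℝ) / 2) ^ n₀ ≤ 1 := pow_le_one₀ (by norm_num) (by norm_num)
    have h2 : (0 : ℝ) < (1 / 2) ^ n := by positivity
    nlinarith
  obtain ⟨K, hK⟩ := cauchySeq_tendsto_of_complete
    (cauchySeq_of_le_geometric (1 / 2) 65 (by norm_num) hu)
  rw [tendsto_add_atTop_iff_nat] at hK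
  have hlog : Tendsto (fun M : ℕ => Nat.log 16 M) atTop atTop :=
    tendsto_atTop.2 fun b => (eventually_ge_atTop (16 ^ b)).mono fun M hM =>
      Nat.le_log_of_pow_le (by norm_num) hM
  have h1 : Tendsto (fun M : ℕ => klTruncPath U (M : ℝ) ω - u (Nat.log 16 M)) atTop (𝓝 0) := by
    rw [tendsto_zero_iff_norm_tendsto_zero]
    have hgeo : Tendsto (fun M : ℕ => 65 * (1 / 2 : ℝ) ^ Nat.log 16 M) atTop (𝓝 0) := by
      have := ((tendsto_pow_atTop_nhds_zero_of_lt_one (r := (1 / 2 : ℝ)) (by norm_num)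
        (by norm_num)).comp hlog).const_mul 65
      rwa [mul_zero] at this
    refine squeeze_zero' (Eventually.of_forall fun _ => norm_nonneg _) ?_ hgeo
    filter_upwards [hlog.eventually_ge_atTop n₀, eventually_ge_atTop 1] with M hM hM1
    exact norm_klTruncPath_sub_le hω (hn₀ _ hM) (Finset.mem_Icc.2
      ⟨Nat.pow_log_le_self 16 (by omega), (Nat.lt_pow_succ_log_self (by norm_num) M).le⟩)
  have h2 : Tendsto (fun M : ℕ => klTruncPath U (M : ℝ) ω) atTop (𝓝 K) := by
    have := h1.add (hK.comp hlog)
    simpa using this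
  refine ⟨K, (h2.comp tendsto_nat_floor_atTop).congr' ?_⟩
  filter_upwards [eventually_ge_atTop 0] with H hH
  exact klTruncPath_floor hH ω

variable [MeasurableSpace Ω] {P : Measure Ω} [IsProbabilityMeasure P]

theorem hasExpBound_klTrunc (hU : iIndepFun U P) (hlaw : ∀ h, HasLaw (U h) sharpLaw P) (H : ℝ)
    {t : ℝ} (ht : t ∈ Icc (0 : ℝ) 1) : HasExpBound (klTrunc U H t) 1 P := by
  classical
  refine (hasExpBound_sum hU hlaw (freqUpTo S H) fun h => klCoeff h t).mono ?_
  exact (sum_subtype_le (f := fun h => ‖klCoeff h t‖ ^ 2) (fun _ => by positivity)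
    fun h hh => Finset.mem_image_of_mem Subtype.val hh).trans
    ((sum_norm_klCoeff_sq_le ht _).trans ht.2)

theorem hasExpBound_klTrunc_sub (hU : iIndepFun U P) (hlaw : ∀ h, HasLaw (U h) sharpLaw P)
    {H H' : ℝ} (hH : 1 ≤ H) (hHH' : H ≤ H') (t : ℝ) :
    HasExpBound (fun ω => klTrunc U H' t ω - klTrunc U H t ω) (1 / H) P := by
  classical
  simp only [klTrunc_sub hHH']
  exact (hasExpBound_sum hU hlaw _ fun h => klCoeff h t).mono (sum_norm_klCoeff_sq_sdiff_le hH t)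

/-- A tenth moment is `O(16 ^ (-5 n))`, so that each of the at most `32 * 512 ^ n` events in the
union has probability `O(1024 ^ (-n))`. -/
theorem measure_oscillationEvent_le (hU : iIndepFun U P) (hlaw : ∀ h, HasLaw (U h) sharpLaw P)
    (n : ℕ) : P (oscillationEvent U n) ≤ ENNReal.ofReal (32 * momentConst 10 * (1 / 2) ^ n) := by
  set e := momentConst 10 * (1 / 1024) ^ n
  have he : 0 < e := mul_pos (momentConst_pos _) (by positivity)
  have h1 : ∀ M ∈ Finset.Icc (16 ^ n) (16 ^ (n + 1)), ∀ j ∈ Finset.range (32 ^ n + 1),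
      P {ω | (1 / 2 : ℝ) ^ n ≤ ‖klTrunc U (M : ℕ) ((j : ℕ) / 32 ^ n : ℝ) ω
        - klTrunc U ((16 ^ n : ℕ) : ℝ) ((j : ℕ) / 32 ^ n : ℝ) ω‖} ≤ ENNReal.ofReal e := by
    intro M hM j _
    have hM' := (Finset.mem_Icc.1 hM).1
    have h2 := hasExpBound_klTrunc_sub hU hlaw (H := ((16 ^ n : ℕ) : ℝ)) (H' := M)
      (by exact_mod_cast Nat.one_le_pow _ _ (by norm_num)) (by exact_mod_cast hM') (j / 32 ^ n)
    refine (h2.measure_le (by positivity) 5 (a := (1 / 2) ^ n) (by positivity)).trans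
      (ENNReal.ofReal_le_ofReal (le_of_eq ?_))
    push_cast
    norm_num
    rw [mul_div_assoc, ← pow_mul, ← pow_mul, mul_comm n 5, mul_comm n 10, pow_mul, pow_mul,
      ← inv_pow, ← div_pow]
    norm_num [e]
  calc P (oscillationEvent U n)
      ≤ ∑ M ∈ Finset.Icc (16 ^ n) (16 ^ (n + 1)), ∑ j ∈ Finset.range (32 ^ n + 1),
        ENNReal.ofReal e := by
        refine (measure_biUnion_finset_le _ _).trans (Finset.sum_le_sum fun M hM => ?_)
        exact (measure_biUnion_finset_le _ _).trans (Finset.sum_le_sum fun j hj => h1 M hM j hj)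
    _ = ENNReal.ofReal (((16 ^ (n + 1) + 1 - 16 ^ n : ℕ) : ℝ) * (((32 ^ n + 1 : ℕ) : ℝ) * e)) := by
        simp only [Finset.sum_const, Nat.card_Icc, Finset.card_range, nsmul_eq_mul]
        rw [ENNReal.ofReal_mul (Nat.cast_nonneg _), ENNReal.ofReal_mul (Nat.cast_nonneg _),
          ENNReal.ofReal_natCast, ENNReal.ofReal_natCast]
    _ ≤ _ := by
        refine ENNReal.ofReal_le_ofReal ?_
        have h3 : ((16 ^ (n + 1) + 1 - 16 ^ n : ℕ) : ℝ) ≤ 16 * 16 ^ n := by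
          have : 16 ^ (n + 1) + 1 - 16 ^ n ≤ 16 * 16 ^ n := by
            have := Nat.one_le_pow n 16 (by norm_num)
            rw [pow_succ]
            omega
          exact_mod_cast this
        have h4 : ((32 ^ n + 1 : ℕ) : ℝ) ≤ 2 * 32 ^ n := by
          have : 32 ^ n + 1 ≤ 2 * 32 ^ n := by
            have := Nat.one_le_pow n 32 (by norm_num)
            omega
          exact_mod_cast this
        calc _ ≤ (16 * 16 ^ n) * ((2 * 32 ^ n) * e) := by gcongr
          _ = 32 * momentConst 10 * (16 * 32 * (1 / 1024)) ^ n := by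
            rw [mul_pow, mul_pow]; ring
          _ = _ := by norm_num

theorem ae_exists_tendsto_klTruncPath (hU : iIndepFun U P)
    (hlaw : ∀ h, HasLaw (U h) sharpLaw P) :
    ∀ᵐ ω ∂P, ∃ K, Tendsto (fun H : ℝ => klTruncPath U H ω) atTop (𝓝 K) := by
  have hs : ∑' n, P (oscillationEvent U n) ≠ ⊤ := by
    refine ne_top_of_le_ne_top ?_
      (ENNReal.tsum_le_tsum fun n => measure_oscillationEvent_le hU hlaw n)
    have hsum : Summable fun n : ℕ => 32 * momentConst 10 * (1 / 2 : ℝ) ^ n :=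
      (summable_geometric_two).mul_left _
    have := momentConst_pos 10
    rw [← ENNReal.ofReal_tsum_of_nonneg (fun n => by positivity) hsum]
    exact ENNReal.ofReal_ne_top
  filter_upwards [ae_eventually_notMem hs, ae_all_iff.2 fun h => ae_abs_le_two (hlaw h)]
    with ω h1 h2
  exact exists_tendsto_klTruncPath h2 h1

end Convergence

/-! ### Moments of the limit -/

section Limit

variable {Ω : Type*} {S : Set ℤ} {U : S → Ω → ℝ}

/-- The limit of the truncated sums in the space of paths, where it exists (an arbitrary path
otherwise). -/
def klPath (U : S → Ω → ℝ) (ω : Ω) : C(Icc (0 : ℝ) 1, ℂ) :=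
  limUnder atTop fun H : ℝ => klTruncPath U H ω

theorem tendsto_klPath {ω : Ω} (h : ∃ K, Tendsto (fun H : ℝ => klTruncPath U H ω) atTop (𝓝 K)) :
    Tendsto (fun H : ℝ => klTruncPath U H ω) atTop (𝓝 (klPath U ω)) :=
  tendsto_nhds_limUnder h

theorem tendsto_klTrunc_of_tendsto {ω : Ω} {K : C(Icc (0 : ℝ) 1, ℂ)}
    (h : Tendsto (fun H : ℝ => klTruncPath U H ω) atTop (𝓝 K)) (t : Icc (0 : ℝ) 1) :
    Tendsto (fun H : ℝ => klTrunc U H t ω) atTop (𝓝 (K t)) := by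
  have h1 : Tendsto (fun H : ℝ => klTruncPath U H ω t) atTop (𝓝 (K t)) :=
    ((continuous_eval_const (F := C(Icc (0 : ℝ) 1, ℂ)) t).tendsto K).comp h
  exact h1

theorem klSeries_eq_of_tendsto {ω : Ω} {K : C(Icc (0 : ℝ) 1, ℂ)}
    (h : Tendsto (fun H : ℝ => klTruncPath U H ω) atTop (𝓝 K)) (t : Icc (0 : ℝ) 1) :
    klSeries U t ω = K t :=
  (tendsto_klTrunc_of_tendsto h t).limUnder_eq

variable [MeasurableSpace Ω] {P : Measure Ω}

theorem aemeasurable_klTruncPath (hlaw : ∀ h, HasLaw (U h) sharpLaw P) (H : ℝ) :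
    AEMeasurable (klTruncPath U H) P := by
  have h1 : klTruncPath U H = fun ω => ∑ h ∈ freqUpTo S H, (U h ω) •
      (⟨fun t => klCoeff h t, (continuous_klCoeff h).comp continuous_subtype_val⟩ :
        C(Icc (0 : ℝ) 1, ℂ)) := by
    funext ω
    ext t
    simp [klTruncPath, klTrunc, mul_comm]
  rw [h1]
  exact Finset.aemeasurable_fun_sum _ fun h _ => (hlaw h).aemeasurable.smul_const _

variable [IsProbabilityMeasure P]

theorem ae_tendsto_klTrunc (hU : iIndepFun U P) (hlaw : ∀ h, HasLaw (U h) sharpLaw P)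
    {t : ℝ} (ht : t ∈ Icc (0 : ℝ) 1) :
    ∀ᵐ ω ∂P, Tendsto (fun H : ℝ => klTrunc U H t ω) atTop (𝓝 (klSeries U t ω)) := by
  filter_upwards [ae_exists_tendsto_klTruncPath hU hlaw] with ω ⟨K, hK⟩
  have h1 := tendsto_klTrunc_of_tendsto hK ⟨t, ht⟩
  rwa [← klSeries_eq_of_tendsto hK ⟨t, ht⟩] at h1

theorem aemeasurable_klPath (hU : iIndepFun U P) (hlaw : ∀ h, HasLaw (U h) sharpLaw P) :
    AEMeasurable (klPath U) P :=
  aemeasurable_of_tendsto_metrizable_ae atTop (fun n : ℕ => aemeasurable_klTruncPath hlaw (n : ℝ))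
    ((ae_exists_tendsto_klTruncPath hU hlaw).mono fun _ h =>
      (tendsto_klPath h).comp tendsto_natCast_atTop_atTop)

theorem tendstoInDistribution_klTruncPath (hU : iIndepFun U P)
    (hlaw : ∀ h, HasLaw (U h) sharpLaw P) :
    TendstoInDistribution (fun H : ℝ => klTruncPath U H) atTop (klPath U) (fun _ => P) P :=
  tendstoInDistribution_of_ae_tendsto (aemeasurable_klTruncPath hlaw)
    (aemeasurable_klPath hU hlaw)
    ((ae_exists_tendsto_klTruncPath hU hlaw).mono fun _ h => tendsto_klPath h)

theorem hasExpBound_klSeries (hU : iIndepFun U P) (hlaw : ∀ h, HasLaw (U h) sharpLaw P)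
    {t : ℝ} (ht : t ∈ Icc (0 : ℝ) 1) : HasExpBound (klSeries U t) 1 P :=
  HasExpBound.of_tendsto (fun n : ℕ => hasExpBound_klTrunc hU hlaw (n : ℝ) ht)
    ((ae_tendsto_klTrunc hU hlaw ht).mono fun _ h => h.comp tendsto_natCast_atTop_atTop)

theorem hasExpBound_klSeries_sub (hU : iIndepFun U P) (hlaw : ∀ h, HasLaw (U h) sharpLaw P)
    {t : ℝ} (ht : t ∈ Icc (0 : ℝ) 1) {H : ℝ} (hH : 1 ≤ H) :
    HasExpBound (fun ω => klSeries U t ω - klTrunc U H t ω) (1 / H) P := by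
  refine HasExpBound.of_tendsto (fun n : ℕ => hasExpBound_klTrunc_sub hU hlaw (H' := H + n) hH
    (by simp) t) ((ae_tendsto_klTrunc hU hlaw ht).mono fun ω h => ?_)
  exact (h.comp (tendsto_atTop_add_const_left _ _ tendsto_natCast_atTop_atTop)).sub_const _

theorem integrable_exp_klSeries (hU : iIndepFun U P) (hlaw : ∀ h, HasLaw (U h) sharpLaw P)
    {t : ℝ} (ht : t ∈ Icc (0 : ℝ) 1) (l m : ℕ) :
    Integrable (fun ω => Real.exp (l * (klSeries U t ω).re + m * (klSeries U t ω).im)) P := by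
  have h := hasExpBound_klSeries hU hlaw ht
  have hm := h.1
  have hre : AEMeasurable (fun ω => (klSeries U t ω).re) P :=
    Complex.measurable_re.comp_aemeasurable hm
  have him : AEMeasurable (fun ω => (klSeries U t ω).im) P :=
    Complex.measurable_im.comp_aemeasurable hm
  refine (h.integrable_exp (a := l + m) (by positivity)).mono'
    (AEMeasurable.aestronglyMeasurable (by fun_prop)) (Eventually.of_forall fun ω => ?_)
  rw [Real.norm_of_nonneg (Real.exp_pos _).le, Real.exp_le_exp, add_mul]
  gcongr
  · exact (le_abs_self _).trans (Complex.abs_re_le_norm _)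
  · exact (le_abs_self _).trans (Complex.abs_im_le_norm _)

theorem integral_klTrunc (hlaw : ∀ h, HasLaw (U h) sharpLaw P) (H t : ℝ) :
    ∫ ω, klTrunc U H t ω ∂P = 0 :=
  integral_sum_mul hlaw (freqUpTo S H) fun h => klCoeff h t

theorem integral_klSeries (hU : iIndepFun U P) (hlaw : ∀ h, HasLaw (U h) sharpLaw P)
    {t : ℝ} (ht : t ∈ Icc (0 : ℝ) 1) : ∫ ω, klSeries U t ω ∂P = 0 := by
  have h1 : ∀ᶠ H : ℝ in atTop, ‖∫ ω, klSeries U t ω ∂P‖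
      ≤ momentConst 1 * (1 / H) ^ ((1 : ℝ) / 2) := by
    filter_upwards [eventually_ge_atTop 1] with H hH
    have h2 := hasExpBound_klSeries_sub hU hlaw ht hH
    have h3 := h2.integral_rpow_le (by positivity) zero_le_one
    simp only [Real.rpow_one] at h3
    have h4 : ∫ ω, klSeries U t ω ∂P = ∫ ω, (klSeries U t ω - klTrunc U H t ω) ∂P := by
      rw [integral_sub ((hasExpBound_klSeries hU hlaw ht).integrable one_pos)
        ((hasExpBound_klTrunc hU hlaw H ht).integrable one_pos), integral_klTrunc hlaw, sub_zero]
    rw [h4]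
    exact (norm_integral_le_integral_norm _).trans h3
  have h5 : Tendsto (fun H : ℝ => momentConst 1 * (1 / H) ^ ((1 : ℝ) / 2)) atTop (𝓝 0) := by
    have h6 : Tendsto (fun H : ℝ => 1 / H) atTop (𝓝 0) := tendsto_const_nhds.div_atTop tendsto_id
    have h7 := (h6.rpow_const (p := (1 : ℝ) / 2) (Or.inr (by norm_num))).const_mul (momentConst 1)
    rwa [Real.zero_rpow (by norm_num), mul_zero] at h7
  exact norm_le_zero_iff.1 (ge_of_tendsto h5 h1)

theorem integral_norm_sq_klSeries_le (hU : iIndepFun U P) (hlaw : ∀ h, HasLaw (U h) sharpLaw P)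
    {t : ℝ} (ht : t ∈ Icc (0 : ℝ) 1) : ∫ ω, ‖klSeries U t ω‖ ^ 2 ∂P ≤ 2 * t := by
  classical
  have hb := hasExpBound_klSeries hU hlaw ht
  rw [integral_eq_lintegral_of_nonneg_ae (Eventually.of_forall fun _ => by positivity)
    (hb.integrable_pow one_pos 2).1]
  refine ENNReal.toReal_le_of_le_ofReal (by linarith [ht.1]) ?_
  calc ∫⁻ ω, ENNReal.ofReal (‖klSeries U t ω‖ ^ 2) ∂P
      = ∫⁻ ω, liminf (fun n : ℕ => ENNReal.ofReal (‖klTrunc U (n : ℝ) t ω‖ ^ 2)) atTop ∂P := by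
        refine lintegral_congr_ae ((ae_tendsto_klTrunc hU hlaw ht).mono fun ω hω => ?_)
        refine (Tendsto.liminf_eq ?_).symm
        exact (ENNReal.continuous_ofReal.tendsto _).comp
          ((hω.comp tendsto_natCast_atTop_atTop).norm.pow 2)
    _ ≤ liminf (fun n : ℕ => ∫⁻ ω, ENNReal.ofReal (‖klTrunc U (n : ℝ) t ω‖ ^ 2) ∂P) atTop := by
        refine lintegral_liminf_le' fun n => ?_
        have := (hasExpBound_klTrunc hU hlaw (n : ℝ) ht).1
        fun_prop
    _ ≤ _ := liminf_le_of_le (by isBoundedDefault) fun b hb => by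
        obtain ⟨n, hn⟩ := hb.exists
        refine hn.trans ?_
        rw [← ofReal_integral_eq_lintegral_ofReal
          ((hasExpBound_klTrunc hU hlaw (n : ℝ) ht).integrable_pow one_pos 2)
          (Eventually.of_forall fun _ => by positivity)]
        refine ENNReal.ofReal_le_ofReal ?_
        have h1 := integral_norm_sq_sum_mul hU hlaw (freqUpTo S n) fun h => klCoeff h t
        refine h1.le.trans ?_
        gcongr
        exact (sum_subtype_le (f := fun h => ‖klCoeff h t‖ ^ 2) (fun _ => by positivity)
          fun h hh => Finset.mem_image_of_mem Subtype.val hh).trans (sum_norm_klCoeff_sq_le ht _)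

end Limit

/-! ### Anticoncentration over disjoint blocks -/

section Blocks

variable {Ω : Type*} {ι : Type*} {U : ι → Ω → ℝ}

open Classical in
/-- A weighted sum over `F`, as a function of the family of variables indexed by `T ⊇ F`. -/
def blockSum (T F : Finset ι) (w : ι → ℂ) (x : T → ℝ) : ℂ :=
  ∑ h ∈ F, w h * ((if hh : h ∈ T then x ⟨h, hh⟩ else 0 : ℝ) : ℂ)

theorem blockSum_apply {T F : Finset ι} (hFT : F ⊆ T) (w : ι → ℂ) (ω : Ω) :
    blockSum T F w (fun h => U h ω) = ∑ h ∈ F, w h * (U h ω : ℂ) :=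
  Finset.sum_congr rfl fun h hh => by rw [dif_pos (hFT hh)]

theorem measurable_blockSum (T F : Finset ι) (w : ι → ℂ) : Measurable (blockSum T F w) := by
  unfold blockSum
  refine Finset.measurable_fun_sum _ fun h _ => Measurable.const_mul ?_ _
  split_ifs <;> fun_prop

variable [MeasurableSpace Ω] {P : Measure Ω} [IsProbabilityMeasure P]

/-- Weighted sums over disjoint blocks of variables are simultaneously small with probability
exponentially small in the number of blocks. -/
theorem measure_forall_norm_sum_lt_le (hU : iIndepFun U P) (hlaw : ∀ h, HasLaw (U h) sharpLaw P)
    {F : ℕ → Finset ι} (hF : Pairwise fun i j => Disjoint (F i) (F j)) (w : ℕ → ι → ℂ) {a : ℝ}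
    (ha0 : 0 < a) (m : ℕ) (ha : ∀ i < m, a ^ 2 ≤ ∑ h ∈ F i, ‖w i h‖ ^ 2) :
    P {ω | ∀ i < m, ‖∑ h ∈ F i, w i h * (U h ω : ℂ)‖ < a}
      ≤ ENNReal.ofReal (1 - spreadConst) ^ m := by
  classical
  induction m with
  | zero => simp
  | succ m ih =>
    set T := (Finset.range m).biUnion F
    have hT : Disjoint T (F m) := (Finset.disjoint_biUnion_left _ _ _).2 fun i hi =>
      hF (Finset.mem_range.1 hi).ne
    have hind := hU.indepFun_finset₀ T (F m) hT fun h => (hlaw h).aemeasurable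
    have hs : MeasurableSet {x : T → ℝ | ∀ i < m, ‖blockSum T (F i) (w i) x‖ < a} := by
      simp only [Set.ofPred_forall]
      exact MeasurableSet.iInter fun i => MeasurableSet.iInter fun _ =>
        measurableSet_lt (measurable_blockSum _ _ _).norm measurable_const
    have ht : MeasurableSet {x : F m → ℝ | ‖blockSum (F m) (F m) (w m) x‖ < a} :=
      measurableSet_lt (measurable_blockSum _ _ _).norm measurable_const
    have h1 := hind.measure_inter_preimage_eq_mul _ _ hs ht
    have h2 : (fun ω (i : T) => U i ω) ⁻¹' {x : T → ℝ | ∀ i < m, ‖blockSum T (F i) (w i) x‖ < a}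
        = {ω | ∀ i < m, ‖∑ h ∈ F i, w i h * (U h ω : ℂ)‖ < a} := by
      ext ω
      refine forall₂_congr fun i hi => ?_
      rw [blockSum_apply (U := U) (Finset.subset_biUnion_of_mem F (Finset.mem_range.2 hi))]
    have h3 : (fun ω (i : F m) => U i ω) ⁻¹' {x : F m → ℝ | ‖blockSum (F m) (F m) (w m) x‖ < a}
        = {ω | ‖∑ h ∈ F m, w m h * (U h ω : ℂ)‖ < a} := by
      ext ω
      simp only [Set.mem_preimage, Set.mem_ofPred_eq]
      rw [blockSum_apply (U := U) (Finset.Subset.refl _)]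
    rw [h2, h3] at h1
    calc P {ω | ∀ i < m + 1, ‖∑ h ∈ F i, w i h * (U h ω : ℂ)‖ < a}
        ≤ P ({ω | ∀ i < m, ‖∑ h ∈ F i, w i h * (U h ω : ℂ)‖ < a}
          ∩ {ω | ‖∑ h ∈ F m, w m h * (U h ω : ℂ)‖ < a}) :=
          measure_mono fun ω hω => ⟨fun i hi => hω i (by omega), hω m (by omega)⟩
      _ ≤ ENNReal.ofReal (1 - spreadConst) ^ m * ENNReal.ofReal (1 - spreadConst) := by
          rw [h1]
          gcongr
          · exact ih fun i hi => ha i (by omega)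
          · exact measure_norm_sum_lt_le hU hlaw (F m) (w m) ha0 (ha m (by omega))
      _ = _ := (pow_succ _ _).symm

end Blocks

/-! ### The band kernel -/

/-- The character `e(nt) = exp (2πi n t)`. -/
def expChar (n : ℤ) (t : ℝ) : ℂ := Complex.exp (2 * Real.pi * Complex.I * n * t)

theorem continuous_expChar (n : ℤ) : Continuous (expChar n) := by unfold expChar; fun_prop

theorem expChar_add_left (m n : ℤ) (t : ℝ) : expChar (m + n) t = expChar m t * expChar n t := by
  rw [expChar, expChar, expChar, ← Complex.exp_add]; push_cast; ring_nf

theorem expChar_add_right (n : ℤ) (t s : ℝ) : expChar n (t + s) = expChar n t * expChar n s := by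
  rw [expChar, expChar, expChar, ← Complex.exp_add]; push_cast; ring_nf

theorem expChar_zero (t : ℝ) : expChar 0 t = 1 := by simp [expChar]

theorem norm_expChar (n : ℤ) (t : ℝ) : ‖expChar n t‖ = 1 := by
  rw [expChar, Complex.norm_exp]; simp

theorem conj_expChar (n : ℤ) (t : ℝ) : (starRingEnd ℂ) (expChar n t) = expChar (-n) t := by
  rw [expChar, expChar, ← Complex.exp_conj]
  congr 1
  simp only [map_mul, Complex.conj_ofReal, Complex.conj_I, map_intCast, map_ofNat]
  push_cast
  ring

theorem integral_expChar (n : ℤ) :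
    ∫ s in (-(1 / 2) : ℝ)..(1 / 2), expChar n s = if n = 0 then 1 else 0 := by
  split_ifs with hn
  · subst hn
    simp only [expChar_zero, intervalIntegral.integral_const]
    norm_num
  · have hc : (2 * Real.pi * Complex.I * n : ℂ) ≠ 0 := by
      simp [hn, Real.pi_ne_zero]
    unfold expChar
    rw [integral_exp_mul_complex hc]
    have h1 : Complex.exp (2 * Real.pi * Complex.I * n * ((1 / 2 : ℝ) : ℂ))
        = Complex.exp (2 * Real.pi * Complex.I * n * ((-(1 / 2) : ℝ) : ℂ)) := by
      rw [Complex.exp_eq_exp_iff_exists_int]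
      exact ⟨n, by push_cast; ring⟩
    rw [h1, sub_self, zero_div]

/-- The real part of `klCoeff h`, freed from the term of frequency `0`: it is odd and
`1`-periodic. -/
def sinTerm (h : ℤ) (t : ℝ) : ℝ :=
  if h = 0 then 0 else Real.sin (2 * Real.pi * h * t) / (2 * Real.pi * h)

theorem continuous_sinTerm (h : ℤ) : Continuous (sinTerm h) := by
  unfold sinTerm; split_ifs <;> fun_prop

theorem sinTerm_eq {h : ℤ} (hh : h ≠ 0) (t : ℝ) :
    (sinTerm h t : ℂ) = (expChar h t - expChar (-h) t) / (4 * Real.pi * Complex.I * h) := by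
  have h0 : (h : ℂ) ≠ 0 := by exact_mod_cast hh
  have hpi : (Real.pi : ℂ) ≠ 0 := by exact_mod_cast Real.pi_ne_zero
  have hsin := Complex.two_sin (2 * Real.pi * h * t)
  rw [sinTerm, if_neg hh, expChar, expChar]
  push_cast
  rw [show (2 * Real.pi * Complex.I * h * t : ℂ) = (2 * Real.pi * h * t) * Complex.I by ring,
    show (2 * Real.pi * Complex.I * (-h) * t : ℂ) = -(2 * Real.pi * h * t) * Complex.I by ring,
    eq_div_iff (by simp [hpi, h0])]
  rw [show Complex.sin (2 * Real.pi * h * t) / (2 * Real.pi * h) * (4 * Real.pi * Complex.I * h)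
    = (2 * Complex.sin (2 * Real.pi * h * t)) * Complex.I by field_simp; ring, hsin, mul_assoc,
    Complex.I_mul_I]
  ring

theorem re_klCoeff (h : ℤ) (t : ℝ) : (klCoeff h t).re = sinTerm h t + if h = 0 then t else 0 := by
  unfold klCoeff sinTerm
  split_ifs with hh
  · simp
  · have h0 : (h : ℂ) ≠ 0 := by exact_mod_cast hh
    have hpi : (Real.pi : ℂ) ≠ 0 := by exact_mod_cast Real.pi_ne_zero
    have h1 : (Complex.exp (2 * Real.pi * Complex.I * h * t) - 1) / (2 * Real.pi * Complex.I * h)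
        = (((1 / (2 * Real.pi * h) : ℝ) : ℂ)) *
          (-(Complex.I * (Complex.exp (((2 * Real.pi * h * t : ℝ) : ℂ) * Complex.I) - 1))) := by
      rw [div_eq_iff (by simp [h0, hpi])]
      push_cast
      rw [show (2 * Real.pi * Complex.I * h * t : ℂ) = (2 * Real.pi * h * t) * Complex.I by ring]
      field_simp
      rw [Complex.I_sq]
      ring
    rw [h1, Complex.re_ofReal_mul, Complex.neg_re, Complex.I_mul_re, neg_neg, Complex.sub_im,
      Complex.exp_ofReal_mul_I_im, Complex.one_im]
    ring

theorem integral_sinTerm_mul_expChar (h : ℤ) {m : ℕ} (hm : m ≠ 0) (t : ℝ) :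
    ∫ s in (-(1 / 2) : ℝ)..(1 / 2), (sinTerm h (t + s) : ℂ) * expChar (-m) s
      = if h.natAbs = m then expChar m t / (4 * Real.pi * Complex.I * m) else 0 := by
  rcases eq_or_ne h 0 with rfl | hh
  · simp [sinTerm, hm.symm]
  have h1 : ∀ s : ℝ, (sinTerm h (t + s) : ℂ) * expChar (-m) s
      = (4 * Real.pi * Complex.I * h)⁻¹ * (expChar h t * expChar (h - m) s)
        - (4 * Real.pi * Complex.I * h)⁻¹ * (expChar (-h) t * expChar (-h - m) s) := by
    intro s
    rw [sinTerm_eq hh, expChar_add_right, expChar_add_right, sub_eq_add_neg h,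
      sub_eq_add_neg (-h), expChar_add_left, expChar_add_left]
    ring
  have hi : ∀ (c d : ℂ) (n : ℤ), IntervalIntegrable (fun s => c * (d * expChar n s)) volume
      (-(1 / 2)) (1 / 2) := fun c d n =>
    (((continuous_expChar n).const_mul d).const_mul c).intervalIntegrable _ _
  simp only [h1]
  rw [intervalIntegral.integral_sub (hi _ _ _) (hi _ _ _)]
  simp only [intervalIntegral.integral_const_mul, integral_expChar]
  rcases Int.natAbs_eq h with hs | hs
  · by_cases hc : h.natAbs = m
    · rw [if_pos (by omega), if_neg (by omega), if_pos hc]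
      have : h = m := by omega
      rw [this]
      push_cast
      ring
    · rw [if_neg (by omega), if_neg (by omega), if_neg hc]
      ring
  · by_cases hc : h.natAbs = m
    · rw [if_neg (by omega), if_pos (by omega), if_pos hc]
      have : h = -m := by omega
      rw [this]
      push_cast
      rw [neg_neg]
      ring
    · rw [if_neg (by omega), if_neg (by omega), if_neg hc]
      ring

/-- The one-sided Dirichlet sum `∑ e(-js)` over `0 ≤ j < n`. -/
def dirichletSum (n : ℕ) (s : ℝ) : ℂ := ∑ j ∈ Finset.range n, expChar (-j) s

theorem continuous_dirichletSum (n : ℕ) : Continuous (dirichletSum n) :=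
  continuous_finsetSum _ fun _ _ => continuous_expChar _

theorem abs_mul_norm_dirichletSum_le (n : ℕ) {s : ℝ} (hs : |s| ≤ 1 / 2) :
    |s| * ‖dirichletSum n s‖ ≤ 1 / 2 := by
  have hpow : ∀ j : ℕ, expChar (-j) s = expChar (-1) s ^ j := by
    intro j
    rw [expChar, expChar, ← Complex.exp_nat_mul]
    push_cast
    ring_nf
  have h1 : dirichletSum n s * (expChar (-1) s - 1) = expChar (-1) s ^ n - 1 := by
    rw [← geom_sum_mul]
    simp only [dirichletSum, hpow]
  have h2 : ‖expChar (-1) s - 1‖ = 2 * |Real.sin (Real.pi * s)| := by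
    have := norm_exp_sub_exp (-s) 0
    simp only [Complex.ofReal_zero, mul_zero, Complex.exp_zero, sub_zero, mul_neg, Real.sin_neg,
      abs_neg, Complex.ofReal_neg] at this
    rw [← this, expChar]
    simp
  have h3 : 2 * |s| ≤ |Real.sin (Real.pi * s)| := by
    have := Real.mul_abs_le_abs_sin (x := Real.pi * s) (by
      rw [abs_mul, abs_of_pos Real.pi_pos]; nlinarith [Real.pi_pos])
    rw [abs_mul, abs_of_pos Real.pi_pos] at this
    convert this using 1
    field_simp
  have h4 : ‖dirichletSum n s‖ * (2 * |Real.sin (Real.pi * s)|) ≤ 2 := by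
    rw [← h2, ← norm_mul, h1]
    refine (norm_sub_le _ _).trans ?_
    rw [norm_pow, norm_expChar]
    norm_num
  nlinarith [norm_nonneg (dirichletSum n s)]

theorem integral_norm_sq_dirichletSum (n : ℕ) :
    ∫ s in (-(1 / 2) : ℝ)..(1 / 2), ‖dirichletSum n s‖ ^ 2 = n := by
  have h1 : ∀ s, ((‖dirichletSum n s‖ ^ 2 : ℝ) : ℂ)
      = ∑ j ∈ Finset.range n, ∑ k ∈ Finset.range n, expChar ((k : ℤ) - j) s := by
    intro s
    rw [Complex.ofReal_pow, ← Complex.mul_conj', dirichletSum, map_sum, Finset.sum_mul_sum]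
    refine Finset.sum_congr rfl fun j _ => Finset.sum_congr rfl fun k _ => ?_
    rw [conj_expChar, neg_neg, ← expChar_add_left]
    congr 1
    ring
  have h2 : ((∫ s in (-(1 / 2) : ℝ)..(1 / 2), ‖dirichletSum n s‖ ^ 2 : ℝ) : ℂ) = n := by
    rw [← intervalIntegral.integral_ofReal]
    simp only [h1]
    rw [intervalIntegral.integral_finsetSum fun j _ =>
      (continuous_finsetSum _ fun k _ => continuous_expChar _).intervalIntegrable _ _]
    have h3 : ∀ j ∈ Finset.range n, ∫ s in (-(1 / 2) : ℝ)..(1 / 2),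
        ∑ k ∈ Finset.range n, expChar ((k : ℤ) - j) s = 1 := by
      intro j hj
      rw [intervalIntegral.integral_finsetSum fun k _ =>
        (continuous_expChar _).intervalIntegrable _ _]
      simp only [integral_expChar, sub_eq_zero, Nat.cast_inj]
      rw [Finset.sum_ite_eq' , if_pos hj]
    rw [Finset.sum_congr rfl h3]
    simp
  exact_mod_cast h2

/-- The index set of the kernel: triples `(i, j, k)` with `i, j < B` and `k < 3 B`. -/
def kernelIndex (B : ℕ) : Finset (ℕ × ℕ × ℕ) :=
  Finset.range B ×ˢ Finset.range B ×ˢ Finset.range (3 * B)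

/-- The frequency carried by a triple. -/
def kernelFreq (N : ℕ) (q : ℕ × ℕ × ℕ) : ℕ := N + q.1 + q.2.1 + q.2.2

/-- The kernel `e(-Ns) D_B(s)² D_{3B}(s)`, where `D` is `dirichletSum`, expanded into
characters. -/
def bandKernel (N B : ℕ) (s : ℝ) : ℂ := ∑ q ∈ kernelIndex B, expChar (-(kernelFreq N q : ℕ)) s

theorem continuous_bandKernel (N B : ℕ) : Continuous (bandKernel N B) :=
  continuous_finsetSum _ fun _ _ => continuous_expChar _

theorem bandKernel_eq (N B : ℕ) (s : ℝ) : bandKernel N B s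
    = expChar (-N) s * (dirichletSum B s * (dirichletSum B s * dirichletSum (3 * B) s)) := by
  have h1 : ∀ i j k : ℕ, expChar (-(kernelFreq N (i, j, k) : ℕ)) s
      = expChar (-N) s * (expChar (-i) s * (expChar (-j) s * expChar (-k) s)) := by
    intro i j k
    rw [← expChar_add_left, ← expChar_add_left, ← expChar_add_left, kernelFreq]
    congr 1
    push_cast
    ring
  simp only [bandKernel, kernelIndex, Finset.sum_product, h1, ← Finset.mul_sum, ← Finset.sum_mul]
  rfl

theorem abs_mul_norm_bandKernel_le (N B : ℕ) {s : ℝ} (hs : |s| ≤ 1 / 2) :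
    |s| * ‖bandKernel N B s‖ ≤ 1 / 2 * ‖dirichletSum B s‖ ^ 2 := by
  have h1 := abs_mul_norm_dirichletSum_le (3 * B) hs
  rw [bandKernel_eq, norm_mul, norm_mul, norm_mul, norm_expChar, one_mul]
  nlinarith [sq_nonneg ‖dirichletSum B s‖]

theorem integral_bandKernel {N : ℕ} (hN : N ≠ 0) (B : ℕ) :
    ∫ s in (-(1 / 2) : ℝ)..(1 / 2), bandKernel N B s = 0 := by
  unfold bandKernel
  rw [intervalIntegral.integral_finsetSum fun q _ => (continuous_expChar _).intervalIntegrable _ _]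
  refine Finset.sum_eq_zero fun q _ => ?_
  rw [integral_expChar, if_neg]
  unfold kernelFreq
  omega

/-- Integrating a function which is Lipschitz at `t` against the kernel gives `O(B)`, although the
central Fourier coefficients of the kernel are `B ^ 2`. -/
theorem norm_integral_mul_bandKernel_le {G : ℝ → ℝ} (hG : Continuous G) {L t : ℝ} (hL : 0 ≤ L)
    (hLip : ∀ s, |s| ≤ 1 / 2 → |G (t + s) - G t| ≤ L * |s|) {N : ℕ} (hN : N ≠ 0) (B : ℕ) :
    ‖∫ s in (-(1 / 2) : ℝ)..(1 / 2), (G (t + s) : ℂ) * bandKernel N B s‖ ≤ L * B := by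
  have hk := continuous_bandKernel N B
  have h1 : ∫ s in (-(1 / 2) : ℝ)..(1 / 2), (G (t + s) : ℂ) * bandKernel N B s
      = ∫ s in (-(1 / 2) : ℝ)..(1 / 2), ((G (t + s) - G t : ℝ) : ℂ) * bandKernel N B s := by
    have h2 : ∀ s, ((G (t + s) - G t : ℝ) : ℂ) * bandKernel N B s
        = (G (t + s) : ℂ) * bandKernel N B s - (G t : ℂ) * bandKernel N B s := by
      intro s; push_cast; ring
    simp only [h2]
    rw [intervalIntegral.integral_sub (Continuous.intervalIntegrable (by fun_prop) _ _)
      (Continuous.intervalIntegrable (by fun_prop) _ _), intervalIntegral.integral_const_mul,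
      integral_bandKernel hN, mul_zero, sub_zero]
  have hd := continuous_dirichletSum B
  rw [h1]
  calc _ ≤ ∫ s in (-(1 / 2) : ℝ)..(1 / 2), L * (1 / 2 * ‖dirichletSum B s‖ ^ 2) := by
        refine intervalIntegral.norm_integral_le_of_norm_le (by norm_num)
          (Eventually.of_forall fun s hs => ?_) (Continuous.intervalIntegrable (by fun_prop) _ _)
        have hs' : |s| ≤ 1 / 2 := abs_le.2 ⟨hs.1.le, hs.2⟩
        rw [norm_mul, Complex.norm_real, Real.norm_eq_abs]
        calc _ ≤ L * |s| * ‖bandKernel N B s‖ := by gcongr; exact hLip s hs'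
          _ = L * (|s| * ‖bandKernel N B s‖) := by ring
          _ ≤ _ := mul_le_mul_of_nonneg_left (abs_mul_norm_bandKernel_le N B hs') hL
    _ = L * (1 / 2 * B) := by
        rw [intervalIntegral.integral_const_mul, intervalIntegral.integral_const_mul,
          integral_norm_sq_dirichletSum]
    _ ≤ _ := by
        have : (0 : ℝ) ≤ B := by positivity
        nlinarith

/-- The number of triples carrying the frequency `n`, that is, the Fourier coefficient of the
kernel at `-n`. -/
def kernelMult (N B n : ℕ) : ℕ := ((kernelIndex B).filter fun q => kernelFreq N q = n).card

theorem kernelMult_eq_zero {N B n : ℕ} (h : n < N ∨ N + 5 * B ≤ n) : kernelMult N B n = 0 := by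
  rw [kernelMult, Finset.card_eq_zero, Finset.filter_eq_empty_iff]
  rintro ⟨i, j, k⟩ hq
  simp only [kernelIndex, Finset.mem_product, Finset.mem_range, kernelFreq] at hq ⊢
  omega

theorem sq_le_kernelMult {N B n : ℕ} (h1 : N + 2 * B ≤ n) (h2 : n < N + 3 * B) :
    B ^ 2 ≤ kernelMult N B n := by
  have : B ^ 2 = (Finset.range B ×ˢ Finset.range B).card := by
    rw [Finset.card_product, Finset.card_range, sq]
  rw [this]
  refine Finset.card_le_card_of_injOn (fun x => (x.1, x.2, n - N - x.1 - x.2)) ?_ ?_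
  · rintro ⟨i, j⟩ hx
    rw [Finset.mem_coe, Finset.mem_product, Finset.mem_range, Finset.mem_range] at hx
    rw [Finset.mem_coe, Finset.mem_filter]
    simp only [kernelIndex, kernelFreq, Finset.mem_product, Finset.mem_range] at hx ⊢
    omega
  · rintro ⟨i, j⟩ _ ⟨i', j'⟩ _ hx
    simp only [Prod.mk.injEq] at hx ⊢
    exact ⟨hx.1, hx.2.1⟩

theorem sum_kernelMult_le (N B : ℕ) (T : Finset ℕ) :
    ∑ n ∈ T, (kernelMult N B n : ℝ) ≤ 3 * (B : ℝ) ^ 3 := by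
  have h1 : ∑ n ∈ T, kernelMult N B n ≤ (kernelIndex B).card := by
    unfold kernelMult
    rw [Finset.sum_card_fiberwise_eq_card_filter]
    exact Finset.card_filter_le _ _
  have h2 : (kernelIndex B).card = 3 * B ^ 3 := by
    simp only [kernelIndex, Finset.card_product, Finset.card_range]; ring
  rw [h2] at h1
  exact_mod_cast h1

/-! ### Band sums of a sine series -/

/-- The coefficient of `u h` in the integral of `∑ uₕ sinTerm h (t + s)` against
`bandKernel N B s`. -/
def bandCoeff (N B : ℕ) (t : ℝ) (h : ℤ) : ℂ :=
  kernelMult N B h.natAbs * (expChar h.natAbs t / (4 * Real.pi * Complex.I * h.natAbs))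

open Classical in
/-- The frequencies `h ∈ S` with `N ≤ |h| < N + 5 B`, those seen by `bandKernel N B`. -/
def bandBlock (S : Set ℤ) (N B : ℕ) : Finset S :=
  (freqUpTo S ((N + 5 * B : ℕ) : ℝ)).filter fun h =>
    N ≤ (h : ℤ).natAbs ∧ (h : ℤ).natAbs < N + 5 * B

theorem mem_bandBlock {S : Set ℤ} {N B : ℕ} {h : S} :
    h ∈ bandBlock S N B ↔ N ≤ (h : ℤ).natAbs ∧ (h : ℤ).natAbs < N + 5 * B := by
  rw [bandBlock, Finset.mem_filter, mem_freqUpTo, and_iff_right_iff_imp]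
  intro hh
  have h1 : ((h : ℤ).natAbs : ℝ) = |((h : ℤ) : ℝ)| := by simp
  rw [← h1]
  exact_mod_cast hh.2.le

theorem disjoint_bandBlock {S : Set ℤ} {N N' B : ℕ} (h : N + 5 * B ≤ N') :
    Disjoint (bandBlock S N B) (bandBlock S N' B) := by
  rw [Finset.disjoint_left]
  intro x hx hx'
  rw [mem_bandBlock] at hx hx'
  omega

section Deterministic

variable {S : Set ℤ} (u : S → ℝ)

/-- The truncated sine series with coefficients `u`. -/
def sineTrunc (H t : ℝ) : ℝ := ∑ h ∈ freqUpTo S H, sinTerm h t * u h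

/-- The integral of the sine series with coefficients `u`, translated by `t`, against
`bandKernel N B`. -/
def bandSum (N B : ℕ) (t : ℝ) : ℂ := ∑ h ∈ bandBlock S N B, bandCoeff N B t h * (u h : ℂ)

theorem continuous_sineTrunc (H : ℝ) : Continuous (sineTrunc u H) :=
  continuous_finsetSum _ fun h _ => (continuous_sinTerm h).mul continuous_const

theorem integral_sinTerm_mul_bandKernel {N : ℕ} (hN : N ≠ 0) (B : ℕ) (t : ℝ) (h : ℤ) :
    ∫ s in (-(1 / 2) : ℝ)..(1 / 2), (sinTerm h (t + s) : ℂ) * bandKernel N B s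
      = bandCoeff N B t h := by
  have hc := continuous_sinTerm h
  simp only [bandKernel, Finset.mul_sum]
  rw [intervalIntegral.integral_finsetSum fun q _ => by
    have := continuous_expChar (-(kernelFreq N q : ℕ))
    exact Continuous.intervalIntegrable (by fun_prop) _ _]
  have hm : ∀ q, kernelFreq N q ≠ 0 := fun q => by unfold kernelFreq; omega
  simp only [integral_sinTerm_mul_expChar h (hm _)]
  rw [← Finset.sum_filter, bandCoeff, kernelMult]
  have h1 : (kernelIndex B).filter (fun q => h.natAbs = kernelFreq N q)
      = (kernelIndex B).filter (fun q => kernelFreq N q = h.natAbs) := by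
    ext q; simp [eq_comm]
  rw [h1, Finset.sum_congr rfl (g := fun _ => expChar h.natAbs t
    / (4 * Real.pi * Complex.I * h.natAbs)) fun q hq => by rw [(Finset.mem_filter.1 hq).2],
    Finset.sum_const, nsmul_eq_mul]

theorem integral_sineTrunc_mul_bandKernel {N : ℕ} (hN : N ≠ 0) (B : ℕ) {H : ℝ}
    (hH : ((N + 5 * B : ℕ) : ℝ) ≤ H) (t : ℝ) :
    ∫ s in (-(1 / 2) : ℝ)..(1 / 2), (sineTrunc u H (t + s) : ℂ) * bandKernel N B s
      = bandSum u N B t := by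
  have hk := continuous_bandKernel N B
  have h1 : ∀ s, (sineTrunc u H (t + s) : ℂ) * bandKernel N B s
      = ∑ h ∈ freqUpTo S H, (u h : ℂ) * ((sinTerm h (t + s) : ℂ) * bandKernel N B s) := by
    intro s
    rw [sineTrunc, Complex.ofReal_sum, Finset.sum_mul]
    refine Finset.sum_congr rfl fun h _ => ?_
    push_cast
    ring
  simp only [h1]
  rw [intervalIntegral.integral_finsetSum fun h _ => by
    have := continuous_sinTerm h
    exact Continuous.intervalIntegrable (by fun_prop) _ _]
  simp only [intervalIntegral.integral_const_mul, integral_sinTerm_mul_bandKernel hN]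
  rw [bandSum]
  symm
  simp only [mul_comm (bandCoeff N B t _)]
  refine Finset.sum_subset (fun h hh => freqUpTo_mono hH (Finset.mem_filter.1 hh).1)
    fun h _ hh => ?_
  rw [mem_bandBlock] at hh
  rw [bandCoeff, kernelMult_eq_zero (by omega), Nat.cast_zero, zero_mul, mul_zero]

variable {u}

/-- The band sums are small at a point where the sum of the sine series is Lipschitz. -/
theorem norm_bandSum_le {G : ℝ → ℝ} (hu : TendstoUniformly (sineTrunc u) G atTop) {L t : ℝ}
    (hL : 0 ≤ L) (hLip : ∀ s, |s| ≤ 1 / 2 → |G (t + s) - G t| ≤ L * |s|) {N : ℕ} (hN : N ≠ 0)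
    (B : ℕ) : ‖bandSum u N B t‖ ≤ L * B := by
  have hG : Continuous G :=
    hu.continuous (Frequently.of_forall fun H => continuous_sineTrunc u H)
  have hk := continuous_bandKernel N B
  obtain ⟨C, hC⟩ := isCompact_Icc.exists_bound_of_continuousOn (s := Icc (-(1 / 2) : ℝ) (1 / 2))
    hk.continuousOn
  have hlim : Tendsto (fun H => ∫ s in (-(1 / 2) : ℝ)..(1 / 2),
      (sineTrunc u H (t + s) : ℂ) * bandKernel N B s) atTop
      (𝓝 (∫ s in (-(1 / 2) : ℝ)..(1 / 2), (G (t + s) : ℂ) * bandKernel N B s)) := by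
    obtain ⟨A, hA⟩ := isCompact_Icc.exists_bound_of_continuousOn
      (s := Icc (t - 1 / 2 : ℝ) (t + 1 / 2)) hG.continuousOn
    refine intervalIntegral.tendsto_integral_filter_of_dominated_convergence
      (fun _ => (A + 1) * C) ?_ ?_ (by simp) ?_
    · refine Eventually.of_forall fun H => ?_
      have := continuous_sineTrunc u H
      exact Continuous.aestronglyMeasurable (by fun_prop)
    · filter_upwards [Metric.tendstoUniformly_iff.1 hu 1 one_pos] with H hH
      refine Eventually.of_forall fun s hs => ?_
      rw [uIoc_of_le (by norm_num)] at hs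
      have h1 := hH (t + s)
      have h2 := hA (t + s) ⟨by linarith [hs.1], by linarith [hs.2]⟩
      have h3 := hC s ⟨hs.1.le, hs.2⟩
      rw [Real.dist_eq, abs_sub_comm] at h1
      rw [norm_mul, Complex.norm_real, Real.norm_eq_abs]
      rw [Real.norm_eq_abs] at h2
      have h4 : |sineTrunc u H (t + s)| ≤ A + 1 := by
        have := abs_sub_abs_le_abs_sub (sineTrunc u H (t + s)) (G (t + s))
        linarith
      have h5 : 0 ≤ A + 1 := (abs_nonneg _).trans h4
      gcongr
    · refine Eventually.of_forall fun s _ => ?_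
      exact ((Complex.continuous_ofReal.tendsto _).comp (hu.tendsto_at (t + s))).mul_const _
  have hev : ∀ᶠ H in atTop, bandSum u N B t = ∫ s in (-(1 / 2) : ℝ)..(1 / 2),
      (sineTrunc u H (t + s) : ℂ) * bandKernel N B s := by
    filter_upwards [eventually_ge_atTop ((N + 5 * B : ℕ) : ℝ)] with H hH
    exact (integral_sineTrunc_mul_bandKernel u hN B hH t).symm
  have h1 := tendsto_nhds_unique (tendsto_const_nhds.congr' hev) hlim
  rw [h1]
  exact norm_integral_mul_bandKernel_le hG hL hLip hN B

theorem norm_bandSum_sub_le (hu : ∀ h, |u h| ≤ 2) {N : ℕ} (hN : N ≠ 0) (B : ℕ) (t t' : ℝ) :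
    ‖bandSum u N B t - bandSum u N B t'‖ ≤ 6 * (B : ℝ) ^ 3 * |t - t'| := by
  classical
  have h1 : ∀ h ∈ bandBlock S N B,
      ‖bandCoeff N B t h * (u h : ℂ) - bandCoeff N B t' h * (u h : ℂ)‖
        ≤ kernelMult N B (h : ℤ).natAbs * |t - t'| := by
    intro h hh
    set n := (h : ℤ).natAbs
    have hn : (0 : ℝ) < n := by
      have := (mem_bandBlock.1 hh).1
      exact_mod_cast (by omega : 0 < n)
    have h2 : ‖expChar n t - expChar n t'‖ ≤ 2 * Real.pi * (n * |t - t'|) := by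
      have := norm_exp_sub_exp_le (n * t) (n * t')
      rw [← mul_sub, abs_mul, abs_of_pos hn] at this
      simpa [expChar, mul_assoc] using this
    have h3 : bandCoeff N B t h * (u h : ℂ) - bandCoeff N B t' h * (u h : ℂ)
        = kernelMult N B n * ((expChar n t - expChar n t') / (4 * Real.pi * Complex.I * n)
          * u h) := by
      simp only [bandCoeff, n]; ring
    rw [h3, norm_mul, norm_mul, norm_div, Complex.norm_real, Real.norm_eq_abs, Complex.norm_natCast]
    refine mul_le_mul_of_nonneg_left ?_ (Nat.cast_nonneg _)
    have h4 : ‖(4 * Real.pi * Complex.I * n : ℂ)‖ = 4 * Real.pi * n := by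
      simp [abs_of_pos Real.pi_pos]
    rw [h4]
    calc _ ≤ 2 * Real.pi * (n * |t - t'|) / (4 * Real.pi * n) * 2 := by
          gcongr
          exact hu h
      _ = _ := by
          have := Real.pi_pos
          field_simp
          ring
  have h5 := sum_subtype_le (S := S) (F := bandBlock S N B)
    (f := fun h => (kernelMult N B h.natAbs : ℝ)) (fun _ => Nat.cast_nonneg _)
    fun h hh => Finset.mem_image_of_mem Subtype.val hh
  have h6 := sum_natAbs_le (F := (bandBlock S N B).image Subtype.val)
    (g := fun n => (kernelMult N B n : ℝ)) (fun _ => Nat.cast_nonneg _)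
    fun h hh => Finset.mem_image_of_mem Int.natAbs hh
  have h7 := sum_kernelMult_le N B (((bandBlock S N B).image Subtype.val).image Int.natAbs)
  rw [bandSum, bandSum, ← Finset.sum_sub_distrib]
  refine (norm_sum_le _ _).trans ((Finset.sum_le_sum h1).trans ?_)
  rw [← Finset.sum_mul]
  refine mul_le_mul_of_nonneg_right ?_ (abs_nonneg _)
  linarith

end Deterministic

/-- An arithmetic progression of difference `p` has at least `B / p` terms in the central band of
the kernel. -/
theorem le_sum_norm_bandCoeff_sq {S : Set ℤ} {p : ℕ} (hp : 0 < p) {h₀ : ℤ}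
    (hS : ∀ k : ℤ, h₀ + p * k ∈ S) {N B : ℕ} {A : ℝ}
    (hA : ((N + 3 * B : ℕ) : ℝ) ≤ A) (t : ℝ) :
    ((B / p : ℕ) : ℝ) * ((B : ℝ) ^ 2 / (4 * Real.pi * A)) ^ 2
      ≤ ∑ h ∈ bandBlock S N B, ‖bandCoeff N B t h‖ ^ 2 := by
  classical
  have hp' : (0 : ℤ) < p := by exact_mod_cast hp
  set b : ℤ := (N + 2 * B : ℕ) + (h₀ - (N + 2 * B : ℕ)) % p
  have hb0 : ((N + 2 * B : ℕ) : ℤ) ≤ b := by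
    have := Int.emod_nonneg (h₀ - (N + 2 * B : ℕ)) hp'.ne'
    omega
  have hb1 : b < (N + 2 * B : ℕ) + p := by
    have := Int.emod_lt_of_pos (h₀ - (N + 2 * B : ℕ)) hp'
    omega
  have hbS : ∀ k : ℕ, b + p * k ∈ S := by
    intro k
    have h1 := Int.emod_add_mul_ediv (h₀ - (N + 2 * B : ℕ)) p
    have h2 : b + p * k = h₀ + p * (k - (h₀ - (N + 2 * B : ℕ)) / p) := by
      rw [mul_sub]; simp only [b]; linarith
    rw [h2]
    exact hS _
  have hk : ∀ k < B / p, b + p * k < N + 3 * B := by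
    intro k hk
    have h1 : p * (k + 1) ≤ B :=
      (Nat.mul_le_mul_left p hk).trans (Nat.mul_div_le B p)
    have h2 : (p : ℤ) * (k + 1) ≤ B := by exact_mod_cast h1
    push_cast at hb1
    linarith
  have hk0 : ∀ k : ℕ, ((N + 2 * B : ℕ) : ℤ) ≤ b + p * k := fun k => by
    have : (0 : ℤ) ≤ p * k := by positivity
    omega
  set f : ℕ → S := fun k => ⟨b + p * k, hbS k⟩
  have hf : Set.InjOn f (Finset.range (B / p)) := by
    intro x _ y _ hxy
    have h1 : b + p * (x : ℤ) = b + p * y := congrArg Subtype.val hxy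
    have h2 := mul_left_cancel₀ hp'.ne' (add_left_cancel h1)
    exact_mod_cast h2
  have hsub : (Finset.range (B / p)).image f ⊆ bandBlock S N B := by
    intro x hx
    obtain ⟨k, hk', rfl⟩ := Finset.mem_image.1 hx
    have h1 := hk k (Finset.mem_range.1 hk')
    have h2 := hk0 k
    rw [mem_bandBlock]
    simp only [f]
    omega
  have hterm : ∀ k ∈ Finset.range (B / p),
      ((B : ℝ) ^ 2 / (4 * Real.pi * A)) ^ 2 ≤ ‖bandCoeff N B t (f k)‖ ^ 2 := by
    intro k hk'
    have h1 := hk k (Finset.mem_range.1 hk')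
    have h2 := hk0 k
    set n := (b + p * k : ℤ).natAbs
    have hn1 : N + 2 * B ≤ n := by omega
    have hn2 : n < N + 3 * B := by omega
    have hn0 : (0 : ℝ) < n := by exact_mod_cast (by omega : 0 < n)
    have hnA : (n : ℝ) ≤ A := le_trans (by exact_mod_cast hn2.le) hA
    have hmult : (B : ℝ) ^ 2 ≤ kernelMult N B n := by exact_mod_cast sq_le_kernelMult hn1 hn2
    have h3 : ‖bandCoeff N B t (f k)‖ = kernelMult N B n / (4 * Real.pi * n) := by
      change ‖(kernelMult N B n : ℂ) * (expChar n t / (4 * Real.pi * Complex.I * n))‖ = _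
      rw [norm_mul, norm_div, norm_expChar]
      simp [abs_of_pos Real.pi_pos]
      ring
    rw [h3]
    have := Real.pi_pos
    have hA0 : 0 < A := hn0.trans_le hnA
    gcongr
  calc _ = ∑ k ∈ Finset.range (B / p), ((B : ℝ) ^ 2 / (4 * Real.pi * A)) ^ 2 := by
        rw [Finset.sum_const, Finset.card_range, nsmul_eq_mul]
    _ ≤ ∑ k ∈ Finset.range (B / p), ‖bandCoeff N B t (f k)‖ ^ 2 := Finset.sum_le_sum hterm
    _ = ∑ h ∈ (Finset.range (B / p)).image f, ‖bandCoeff N B t h‖ ^ 2 :=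
        (Finset.sum_image (f := fun h : S => ‖bandCoeff N B t h‖ ^ 2) hf).symm
    _ ≤ _ := Finset.sum_le_sum_of_subset_of_nonneg hsub fun _ _ _ => by positivity

/-! ### Nowhere differentiability -/

theorem spreadConst_le_one : spreadConst ≤ 1 := by
  refine inv_le_one_of_one_le₀ ?_
  unfold momentConst
  have h1 : (1 : ℝ) ≤ (⌈(4 : ℝ)⌉₊.factorial : ℝ) := by exact_mod_cast Nat.factorial_pos _
  have h2 : (1 : ℝ) ≤ 2 * Real.exp 8 := by linarith [Real.one_le_exp (x := 8) (by norm_num)]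
  exact one_le_mul_of_one_le_of_one_le h1 h2

theorem tendsto_gridCard_mul_pow :
    Tendsto (fun R : ℕ => ((R : ℝ) ^ 16 + 1) * (1 - spreadConst) ^ R) atTop (𝓝 0) := by
  have h0 := spreadConst_pos
  have h1 := spreadConst_le_one
  have h2 : |1 - spreadConst| < 1 := by rw [abs_lt]; constructor <;> linarith
  have h3 := tendsto_pow_const_mul_const_pow_of_abs_lt_one 16 h2
  have h4 := tendsto_pow_atTop_nhds_zero_of_abs_lt_one h2
  simpa [add_mul] using h3.add h4

section NowhereDifferentiable

variable {Ω : Type*} {S : Set ℤ} {U : S → Ω → ℝ}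

section Probability

variable [MeasurableSpace Ω] {P : Measure Ω} [IsProbabilityMeasure P]

/-- With `B = R ^ 8`, the frequencies of size about `R ^ 10` contain `R` disjoint bands of
length `5 B`, at each of which the band sum has standard deviation at least `R ^ 9 / (40 π)`. -/
theorem measure_exists_forall_norm_bandSum_le (hU : iIndepFun U P)
    (hlaw : ∀ h, HasLaw (U h) sharpLaw P) {p : ℕ} (hp : 0 < p) {h₀ : ℤ}
    (hS : ∀ k : ℤ, h₀ + p * k ∈ S) {L : ℝ} {R : ℕ} (hpR : p ≤ R)
    (hLR : 40 * Real.pi * (L + 6) < R) :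
    P {ω | (∀ h, |U h ω| ≤ 2) ∧ ∃ t ∈ Icc (0 : ℝ) 1, ∀ N B : ℕ, N ≠ 0 →
        ‖bandSum (fun h => U h ω) N B t‖ ≤ L * B}
      ≤ ENNReal.ofReal (((R : ℝ) ^ 16 + 1) * (1 - spreadConst) ^ R) := by
  have hR : 0 < R := lt_of_lt_of_le hp hpR
  have hR0 : (0 : ℝ) < R := by exact_mod_cast hR
  have hR1 : (1 : ℝ) ≤ R := by exact_mod_cast hR
  have hpi := Real.pi_pos
  have hq : 0 ≤ 1 - spreadConst := by linarith [spreadConst_le_one]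
  set B := R ^ 8
  set N : ℕ → ℕ := fun i => 5 * R ^ 10 + 5 * i * B
  have hN : ∀ i, N i ≠ 0 := fun i => by
    have : 0 < R ^ 10 := by positivity
    simp only [N]; omega
  set a : ℝ := R ^ 9 / (40 * Real.pi)
  have hdisj : Pairwise fun i j => Disjoint (bandBlock S (N i) B) (bandBlock S (N j) B) := by
    have key : ∀ i j, i < j → Disjoint (bandBlock S (N i) B) (bandBlock S (N j) B) := by
      intro i j hij
      refine disjoint_bandBlock ?_
      have := Nat.mul_le_mul_right B (Nat.succ_le_of_lt hij)
      simp only [N]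
      nlinarith
    intro i j hij
    rcases lt_or_gt_of_ne hij with h | h
    · exact key i j h
    · exact (key j i h).symm
  have hvar : ∀ t : ℝ, ∀ i < R, a ^ 2 ≤ ∑ h ∈ bandBlock S (N i) B, ‖bandCoeff (N i) B t h‖ ^ 2 := by
    intro t i hi
    have hA : ((N i + 3 * B : ℕ) : ℝ) ≤ 10 * R ^ 10 := by
      have h1 : (i + 1) * R ^ 8 ≤ R ^ 10 := by
        calc _ ≤ R * R ^ 8 := Nat.mul_le_mul_right _ hi
          _ = R ^ 9 := by ring
          _ ≤ R ^ 10 := Nat.pow_le_pow_right hR (by norm_num)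
      have h2 : N i + 3 * B ≤ 10 * R ^ 10 := by
        have h3 := Nat.zero_le (R ^ 8)
        simp only [N, B]
        linarith
      exact_mod_cast h2
    refine le_trans ?_ (le_sum_norm_bandCoeff_sq hp hS hA t)
    have h3 : (R : ℝ) ^ 7 ≤ (B / p : ℕ) := by
      have : R ^ 7 ≤ B / p := by
        rw [Nat.le_div_iff_mul_le hp]
        calc R ^ 7 * p ≤ R ^ 7 * R := Nat.mul_le_mul_left _ hpR
          _ = R ^ 8 := by ring
      exact_mod_cast this
    have h4 : ((B : ℕ) : ℝ) = R ^ 8 := by simp [B]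
    calc a ^ 2 ≤ R * a ^ 2 := le_mul_of_one_le_left (sq_nonneg _) hR1
      _ = R ^ 7 * (((B : ℕ) : ℝ) ^ 2 / (4 * Real.pi * (10 * R ^ 10))) ^ 2 := by
        rw [h4]
        simp only [a]
        field_simp
        norm_num
      _ ≤ _ := by gcongr
  set E : ℕ → Set Ω := fun j => {ω | ∀ i < R, ‖∑ h ∈ bandBlock S (N i) B,
    bandCoeff (N i) B ((j : ℝ) / R ^ 16) h * (U h ω : ℂ)‖ < a}
  have hE : ∀ j, P (E j) ≤ ENNReal.ofReal (1 - spreadConst) ^ R := fun j =>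
    measure_forall_norm_sum_lt_le hU hlaw hdisj
      (fun i h => bandCoeff (N i) B ((j : ℝ) / R ^ 16) h) (by positivity) R
      fun i hi => hvar _ i hi
  have hsub : {ω | (∀ h, |U h ω| ≤ 2) ∧ ∃ t ∈ Icc (0 : ℝ) 1, ∀ N B : ℕ, N ≠ 0 →
      ‖bandSum (fun h => U h ω) N B t‖ ≤ L * B} ⊆ ⋃ j ∈ Finset.range (R ^ 16 + 1), E j := by
    rintro ω ⟨hω, t, ht, hb⟩
    have hp16 : (0 : ℝ) < R ^ 16 := by positivity
    set j := ⌊t * R ^ 16⌋₊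
    have hj1 : (j : ℝ) ≤ t * R ^ 16 := Nat.floor_le (mul_nonneg ht.1 hp16.le)
    have hj2 : t * R ^ 16 < j + 1 := Nat.lt_floor_add_one _
    have hj : j ∈ Finset.range (R ^ 16 + 1) := by
      rw [Finset.mem_range, Nat.lt_succ_iff]
      have : (j : ℝ) ≤ R ^ 16 := hj1.trans (mul_le_of_le_one_left hp16.le ht.2)
      exact_mod_cast this
    have hdist : |(j : ℝ) / R ^ 16 - t| ≤ 1 / R ^ 16 := by
      rw [abs_sub_comm, abs_of_nonneg (by rw [sub_nonneg, div_le_iff₀ hp16]; exact hj1),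
        sub_le_iff_le_add, ← add_div, le_div_iff₀ hp16]
      linarith
    -- moving `t` to the grid changes a band sum by at most `6 B³ / R ^ 16 = 6 B`
    refine mem_biUnion hj fun i _ => ?_
    have h1 := hb (N i) B (hN i)
    have h2 := norm_bandSum_sub_le hω (hN i) B ((j : ℝ) / R ^ 16) t
    have h3 : 6 * (B : ℝ) ^ 3 * |(j : ℝ) / R ^ 16 - t| ≤ 6 * B := by
      calc _ ≤ 6 * (B : ℝ) ^ 3 * (1 / R ^ 16) := by gcongr
        _ = _ := by
          simp only [B]
          push_cast
          field_simp
    have h4 := norm_le_norm_add_norm_sub' (bandSum (fun h => U h ω) (N i) B ((j : ℝ) / R ^ 16))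
      (bandSum (fun h => U h ω) (N i) B t)
    have h5 : (L + 6) * (B : ℝ) < a := by
      simp only [a, B]
      rw [lt_div_iff₀ (by positivity)]
      push_cast
      have : 0 < (R : ℝ) ^ 8 := by positivity
      nlinarith
    change ‖bandSum (fun h => U h ω) (N i) B ((j : ℝ) / R ^ 16)‖ < a
    linarith
  calc _ ≤ P (⋃ j ∈ Finset.range (R ^ 16 + 1), E j) := measure_mono hsub
    _ ≤ ∑ j ∈ Finset.range (R ^ 16 + 1), ENNReal.ofReal (1 - spreadConst) ^ R :=
        (measure_biUnion_finset_le _ _).trans (Finset.sum_le_sum fun j _ => hE j)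
    _ = _ := by
        rw [Finset.sum_const, Finset.card_range, nsmul_eq_mul, ← ENNReal.ofReal_pow hq,
          ENNReal.ofReal_mul (by positivity)]
        congr 1
        rw [← ENNReal.ofReal_natCast]
        push_cast
        rfl

theorem ae_forall_exists_lt_norm_bandSum (hU : iIndepFun U P)
    (hlaw : ∀ h, HasLaw (U h) sharpLaw P) {p : ℕ} (hp : 0 < p) {h₀ : ℤ}
    (hS : ∀ k : ℤ, h₀ + p * k ∈ S) :
    ∀ᵐ ω ∂P, ∀ L : ℝ, ∀ t ∈ Icc (0 : ℝ) 1, ∃ N B : ℕ, N ≠ 0 ∧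
      L * B < ‖bandSum (fun h => U h ω) N B t‖ := by
  have h1 : ∀ n : ℕ, ∀ᵐ ω ∂P, ¬ ((∀ h, |U h ω| ≤ 2) ∧ ∃ t ∈ Icc (0 : ℝ) 1, ∀ N B : ℕ, N ≠ 0 →
      ‖bandSum (fun h => U h ω) N B t‖ ≤ (n : ℝ) * B) := by
    intro n
    rw [ae_iff]
    simp only [not_not]
    refine le_antisymm ?_ zero_le
    have h2 := (ENNReal.continuous_ofReal.tendsto _).comp tendsto_gridCard_mul_pow
    rw [ENNReal.ofReal_zero] at h2
    refine ge_of_tendsto h2 ?_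
    filter_upwards [eventually_ge_atTop p,
      tendsto_natCast_atTop_atTop.eventually_gt_atTop (40 * Real.pi * ((n : ℝ) + 6))] with R h3 h4
    exact measure_exists_forall_norm_bandSum_le hU hlaw hp hS h3 h4
  filter_upwards [ae_all_iff.2 h1, ae_all_iff.2 fun h => ae_abs_le_two (hlaw h)] with ω h2 h3 L t ht
  obtain ⟨n, hn⟩ := exists_nat_ge L
  by_contra! h4
  exact h2 n ⟨h3, t, ht, fun N B hN => (h4 N B hN).trans (by gcongr)⟩

end Probability

/-- The sine series which is the real part of the random series, freed from its term of
frequency `0` and extended periodically to the line. -/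
theorem exists_tendstoUniformly_sineTrunc {ω : Ω} {K : C(Icc (0 : ℝ) 1, ℂ)}
    (hK : Tendsto (fun H : ℝ => klTruncPath U H ω) atTop (𝓝 K)) :
    ∃ (G : ℝ → ℝ) (c : ℝ), TendstoUniformly (sineTrunc fun h => U h ω) G atTop ∧
      ∀ x ∈ Icc (0 : ℝ) 1, G x = (klSeries U x ω).re - c * x := by
  set u : S → ℝ := fun h => U h ω
  -- the coefficient of the term of frequency `0`, which is absent if `0 ∉ S`
  set c : ℝ := ∑ h ∈ freqUpTo S 0, u h
  have hre : ∀ H : ℝ, 0 ≤ H → ∀ x, (klTrunc U H x ω).re = sineTrunc u H x + c * x := by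
    intro H hH x
    have h1 : (freqUpTo S H).filter (fun h : S => (h : ℤ) = 0) = freqUpTo S 0 := by
      ext h
      rw [Finset.mem_filter, mem_freqUpTo, mem_freqUpTo, abs_nonpos_iff, Int.cast_eq_zero]
      constructor
      · exact fun h => h.2
      · intro h0
        refine ⟨?_, h0⟩
        rw [h0]
        simpa using hH
    rw [klTrunc, re_sum_mul _ (fun h : S => klCoeff h x) u]
    simp only [re_klCoeff, add_mul, Finset.sum_add_distrib, ite_mul, zero_mul]
    rw [← Finset.sum_filter, h1, ← Finset.mul_sum, mul_comm x]
    rfl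
  have hfract : ∀ H x, sineTrunc u H (Int.fract x) = sineTrunc u H x := by
    intro H x
    refine Finset.sum_congr rfl fun h _ => ?_
    congr 1
    unfold sinTerm
    split_ifs
    · rfl
    · congr 1
      have : 2 * Real.pi * ((h : ℤ) : ℝ) * Int.fract x = 2 * Real.pi * ((h : ℤ) : ℝ) * x
          - ((h * ⌊x⌋ : ℤ) : ℝ) * (2 * Real.pi) := by
        rw [Int.fract]; push_cast; ring
      rw [this, Real.sin_sub_int_mul_two_pi]
  set τ : ℝ → Icc (0 : ℝ) 1 := fun x => ⟨Int.fract x, Int.fract_nonneg x, (Int.fract_lt_one x).le⟩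
  have hunif : TendstoUniformly (sineTrunc u) (fun x => (K (τ x)).re - c * Int.fract x) atTop := by
    rw [Metric.tendstoUniformly_iff]
    intro ε hε
    filter_upwards [Metric.tendsto_nhds.1 hK ε hε, eventually_ge_atTop 0] with H hH hH0 x
    have h1 : (K (τ x)).re - c * Int.fract x - sineTrunc u H x
        = (K (τ x) - klTruncPath U H ω (τ x)).re := by
      rw [Complex.sub_re, show (klTruncPath U H ω (τ x)).re
        = sineTrunc u H (Int.fract x) + c * Int.fract x from hre H hH0 _, hfract]
      ring
    rw [Real.dist_eq, h1]
    refine (Complex.abs_re_le_norm _).trans_lt (lt_of_le_of_lt ?_ hH)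
    rw [dist_comm, dist_eq_norm]
    exact (K - klTruncPath U H ω).norm_coe_le_norm (τ x)
  refine ⟨_, c, hunif, fun x hx => ?_⟩
  refine tendsto_nhds_unique (hunif.tendsto_at x) ?_
  have h1 := tendsto_klTrunc_of_tendsto hK ⟨x, hx⟩
  rw [← klSeries_eq_of_tendsto hK ⟨x, hx⟩] at h1
  have h2 := ((Complex.continuous_re.tendsto _).comp h1).sub_const (c * x)
  refine h2.congr' ?_
  filter_upwards [eventually_ge_atTop 0] with H hH
  simp only [Function.comp_apply, hre H hH]
  ring

theorem sineTrunc_neg (u : S → ℝ) (H x : ℝ) : sineTrunc u H (-x) = -sineTrunc u H x := by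
  rw [sineTrunc, sineTrunc, ← Finset.sum_neg_distrib]
  refine Finset.sum_congr rfl fun h _ => ?_
  unfold sinTerm
  split_ifs
  · simp
  · rw [mul_neg, Real.sin_neg]; ring

theorem sineTrunc_add_one (u : S → ℝ) (H x : ℝ) : sineTrunc u H (x + 1) = sineTrunc u H x := by
  refine Finset.sum_congr rfl fun h _ => ?_
  congr 1
  unfold sinTerm
  split_ifs
  · rfl
  · rw [show 2 * Real.pi * ((h : ℤ) : ℝ) * (x + 1)
      = 2 * Real.pi * ((h : ℤ) : ℝ) * x + ((h : ℤ) : ℝ) * (2 * Real.pi) by ring,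
      Real.sin_add_int_mul_two_pi]

/-- A one-sided Lipschitz bound at an end point of `[0, 1]` is two-sided for an odd periodic
function. -/
theorem exists_lipschitz_at_of_isBigO {G : ℝ → ℝ} (hG : Continuous G) (hodd : ∀ x, G (-x) = -G x)
    (hper : ∀ x, G (x + 1) = G x) {t : ℝ} (ht : t ∈ Icc (0 : ℝ) 1)
    (hO : (fun x => G x - G t) =O[𝓝[Icc 0 1] t] fun x => x - t) :
    ∃ L : ℝ, 0 ≤ L ∧ ∀ s, |s| ≤ 1 / 2 → |G (t + s) - G t| ≤ L * |s| := by
  obtain ⟨C, hC0, hC⟩ := hO.exists_nonneg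
  obtain ⟨δ, hδ, hb⟩ := Metric.mem_nhdsWithin_iff.1 hC.bound
  have hb' : ∀ x ∈ Icc (0 : ℝ) 1, |x - t| < δ → |G x - G t| ≤ C * |x - t| := fun x hx hxt =>
    hb ⟨by rwa [Metric.mem_ball, Real.dist_eq], hx⟩
  have hG0 : G 0 = 0 := by
    have := hodd 0
    rw [neg_zero] at this
    linarith
  have hG1 : G 1 = 0 := by rw [← hG0, ← hper 0, zero_add]
  have hloc : ∃ η > 0, ∀ s, |s| < η → |G (t + s) - G t| ≤ C * |s| := by
    rcases eq_or_lt_of_le ht.1 with h0 | h0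
    · subst h0
      refine ⟨min δ 1, by positivity, fun s hs => ?_⟩
      have hs1 := hs.trans_le (min_le_left _ _)
      have hs2 := abs_lt.1 (hs.trans_le (min_le_right _ _))
      rcases le_total 0 s with h | h
      · simpa using hb' s ⟨h, hs2.2.le⟩ (by simpa using hs1)
      · have := hb' (-s) ⟨by linarith, by linarith⟩ (by simpa using hs1)
        simpa [hodd, hG0] using this
    rcases eq_or_lt_of_le ht.2 with h1 | h1
    · subst h1
      refine ⟨min δ 1, by positivity, fun s hs => ?_⟩
      have hs1 := hs.trans_le (min_le_left _ _)
      have hs2 := abs_lt.1 (hs.trans_le (min_le_right _ _))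
      rcases le_total s 0 with h | h
      · simpa using hb' (1 + s) ⟨by linarith, by linarith⟩ (by simpa using hs1)
      · have := hb' (1 + -s) ⟨by linarith, by linarith⟩ (by simpa using hs1)
        rw [add_comm 1, hper, hodd, hG1] at this
        rw [add_comm 1, hper, hG1]
        simpa using this
    · refine ⟨min δ (min t (1 - t)), by
        have : 0 < 1 - t := by linarith
        positivity, fun s hs => ?_⟩
      have hs1 := hs.trans_le (min_le_left _ _)
      have hs2 := abs_lt.1 (hs.trans_le ((min_le_right _ _).trans (min_le_left _ _)))
      have hs3 := abs_lt.1 (hs.trans_le ((min_le_right _ _).trans (min_le_right _ _)))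
      have := hb' (t + s) ⟨by linarith, by linarith⟩ (by simpa using hs1)
      simpa using this
  obtain ⟨η, hη, hη'⟩ := hloc
  obtain ⟨A, hA⟩ := isCompact_Icc.exists_bound_of_continuousOn
    (s := Icc (t - 1 / 2 : ℝ) (t + 1 / 2)) hG.continuousOn
  have hA0 : 0 ≤ A := (norm_nonneg _).trans (hA t ⟨by linarith, by linarith⟩)
  refine ⟨C + 2 * A / η, by positivity, fun s hs => ?_⟩
  rcases lt_or_ge |s| η with h | h
  · refine (hη' s h).trans ?_
    gcongr
    exact le_add_of_nonneg_right (by positivity)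
  · have hs' := abs_le.1 hs
    have h1 := hA (t + s) ⟨by linarith, by linarith⟩
    have h2 := hA t ⟨by linarith, by linarith⟩
    rw [Real.norm_eq_abs] at h1 h2
    have h3 := abs_sub (G (t + s)) (G t)
    have h4 : 2 * A ≤ 2 * A / η * |s| := by
      rw [div_mul_eq_mul_div, le_div_iff₀ hη]
      gcongr
    have h5 : 0 ≤ C * |s| := by positivity
    rw [add_mul]
    linarith

theorem not_differentiableWithinAt_klSeries {ω : Ω} {K : C(Icc (0 : ℝ) 1, ℂ)}
    (hK : Tendsto (fun H : ℝ => klTruncPath U H ω) atTop (𝓝 K)) {t : ℝ} (ht : t ∈ Icc (0 : ℝ) 1)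
    (hband : ∀ L : ℝ, ∃ N B : ℕ, N ≠ 0 ∧ L * B < ‖bandSum (fun h => U h ω) N B t‖) :
    ¬ DifferentiableWithinAt ℝ (fun s => klSeries U s ω) (Icc 0 1) t := by
  intro hd
  obtain ⟨G, c, hu, hGeq⟩ := exists_tendstoUniformly_sineTrunc hK
  have hG : Continuous G := hu.continuous (Frequently.of_forall fun H => continuous_sineTrunc _ H)
  have hodd : ∀ x, G (-x) = -G x := fun x =>
    tendsto_nhds_unique (hu.tendsto_at (-x))
      (by simpa only [sineTrunc_neg] using (hu.tendsto_at x).neg)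
  have hper : ∀ x, G (x + 1) = G x := fun x =>
    tendsto_nhds_unique (hu.tendsto_at (x + 1))
      (by simpa only [sineTrunc_add_one] using hu.tendsto_at x)
  have hre : DifferentiableWithinAt ℝ (fun s => (klSeries U s ω).re) (Icc 0 1) t :=
    Complex.reCLM.differentiableAt.comp_differentiableWithinAt t hd
  have hdG : DifferentiableWithinAt ℝ G (Icc 0 1) t :=
    (hre.sub ((differentiableWithinAt_id).const_mul c)).congr (fun x hx => hGeq x hx) (hGeq t ht)
  obtain ⟨L, hL, hLip⟩ := exists_lipschitz_at_of_isBigO hG hodd hper ht hdG.isBigO_sub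
  obtain ⟨N, B, hN, hNB⟩ := hband L
  exact absurd (norm_bandSum_le hu hL hLip hN B) (not_le.2 hNB)

end NowhereDifferentiable

/-- The frequencies at which `(a₁ - h) b₀` is the particular square `1`. -/
theorem exists_progression_klFreq (p : ℕ) (a₁ b₀ : (ZMod p)ˣ) :
    ∃ h₀ : ℤ, ∀ k : ℤ, h₀ + p * k ∈ klFreq p a₁ b₀ := by
  obtain ⟨h₀, hh⟩ := ZMod.intCast_surjective ((a₁ : ZMod p) - ((b₀⁻¹ : (ZMod p)ˣ) : ZMod p))
  refine ⟨h₀, fun k => ⟨1, ?_⟩⟩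
  push_cast
  rw [hh]
  simp

end

/-! ### Convergence and regularity of the random series -/

theorem mainTheorem7 :
    ∃ (C : ℝ) (D : ℝ → ℝ),
      ∀ (p : ℕ) [Fact p.Prime], p ≠ 2 → ∀ (a₁ b₀ : (ZMod p)ˣ)
        (Ω : Type*) [MeasurableSpace Ω] (P : Measure Ω) [IsProbabilityMeasure P]
        (U : klFreq p a₁ b₀ → Ω → ℝ),
        iIndepFun U P → (∀ h, HasLaw (U h) sharpLaw P) →
        -- almost sure convergence and convergence in law, in `C⁰([0,1], ℂ)`
        (∃ K : Ω → C(Icc (0 : ℝ) 1, ℂ),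
          (∀ᵐ ω ∂P, Tendsto (fun H : ℝ => klTruncPath U H ω) atTop (𝓝 (K ω))) ∧
          TendstoInDistribution (fun H : ℝ => klTruncPath U H) atTop K (fun _ => P) P ∧
          (∀ᵐ ω ∂P, ∀ t : Icc (0 : ℝ) 1, K ω t = klSeries U t ω)) ∧
        -- the limit is almost surely continuous and nowhere differentiable on `[0,1]`
        (∀ᵐ ω ∂P, ContinuousOn (fun t => klSeries U t ω) (Icc 0 1) ∧
          ∀ t ∈ Icc (0 : ℝ) 1,
            ¬ DifferentiableWithinAt ℝ (fun s => klSeries U s ω) (Icc 0 1) t) ∧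
        -- exponential moments, moments of all orders, mean and variance
        (∀ t ∈ Icc (0 : ℝ) 1,
          (∀ l m : ℕ, Integrable
            (fun ω => Real.exp (l * (klSeries U t ω).re + m * (klSeries U t ω).im)) P) ∧
          (∀ k : ℕ, Integrable (fun ω => ‖klSeries U t ω‖ ^ k) P) ∧
          Integrable (klSeries U t) P ∧
          (∫ ω, klSeries U t ω ∂P) = 0 ∧
          (∫ ω, ‖klSeries U t ω - ∫ ω', klSeries U t ω' ∂P‖ ^ 2 ∂P) ≤ 2 * t) ∧
        -- bounds for the truncations, uniform in `p`, `a₁`, `b₀`, `t` and `H`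
        (∀ H : ℝ, 2 ≤ H →
          (∀ᵐ ω ∂P, ‖klTruncPath U H ω‖ ≤ C * Real.log H) ∧
          ∀ t ∈ Icc (0 : ℝ) 1, ∀ k : ℝ, 0 ≤ k →
            Integrable (fun ω => ‖klSeries U t ω - klTrunc U H t ω‖ ^ k) P ∧
            (∫ ω, ‖klSeries U t ω - klTrunc U H t ω‖ ^ k ∂P) ≤ D k * H ^ (-k / 2)) := by
  refine ⟨14, momentConst, ?_⟩
  intro p _ _ a₁ b₀ Ω _ P _ U hU hlaw
  obtain ⟨h₀, hS⟩ := exists_progression_klFreq p a₁ b₀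
  have hconv := ae_exists_tendsto_klTruncPath hU hlaw
  refine ⟨⟨klPath U, hconv.mono fun _ h => tendsto_klPath h,
    tendstoInDistribution_klTruncPath hU hlaw, ?_⟩, ?_, ?_, ?_⟩
  · exact hconv.mono fun _ h t => (klSeries_eq_of_tendsto (tendsto_klPath h) t).symm
  · filter_upwards [hconv,
      ae_forall_exists_lt_norm_bandSum hU hlaw (Nat.Prime.pos Fact.out) hS] with ω ⟨K, hK⟩ hband
    refine ⟨?_, fun t ht => not_differentiableWithinAt_klSeries hK ht fun L => hband L t ht⟩
    rw [continuousOn_iff_continuous_domRestrict]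
    exact K.continuous.congr fun t => (klSeries_eq_of_tendsto hK t).symm
  · intro t ht
    have hb := hasExpBound_klSeries hU hlaw ht
    have hmean := integral_klSeries hU hlaw ht
    refine ⟨integrable_exp_klSeries hU hlaw ht, hb.integrable_pow one_pos, hb.integrable one_pos,
      hmean, ?_⟩
    simp only [hmean, sub_zero]
    exact integral_norm_sq_klSeries_le hU hlaw ht
  · intro H hH
    refine ⟨?_, fun t ht k hk => ?_⟩
    · filter_upwards [ae_all_iff.2 fun h => ae_abs_le_two (hlaw h)] with ω hω
      exact norm_klTruncPath_le hω hH
    · have hb := hasExpBound_klSeries_sub hU hlaw ht (H := H) (by linarith)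
      refine ⟨hb.integrable_rpow (by positivity) hk,
        (hb.integral_rpow_le (by positivity) hk).trans_eq ?_⟩
      rw [one_div, Real.inv_rpow (by linarith), ← Real.rpow_neg (by linarith), neg_div]
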